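/- Let $G=(V,E,\sigma,\tau)$ be a finite directed graph (parallel edges and loops allowed) with edge labels $\sigma:E\to\Sigma$ and edge costs $\tau:E\to\mathbb{N}=\{0,1,2,\dots\}$. The cost of a path is the sum of the costs of its edges, and its word is the sequence of its edge labels (the empty path at each vertex is included). Assume that $G$ is strongly connected, deterministic (distinct edges with the same initial vertex have distinct labels), and cost-diverse (there are two paths with the same initial vertex, the same terminal vertex and the same length but different costs). For $v\in V$ let $N_{G,v}(t)$ be the number of words generated by paths of cost at most $t$ starting in $v$, and let $N_{G,v}(t,n)$ be the number of those words that have length $n$. Put $$C_{G,v}=\limsup_{t\to\infty}\frac{\log_2 N_{G,v}(t)}{t},\qquad C_{G,v}(\alpha)=\limsup_{t\to\infty}\frac{\log_2 N_{G,v}(t,\lfloor\alpha t\rfloor)}{t}\quad(\alpha\ge 0),$$ where $t$ ranges over the positive integers and $\log_2 0:=0$. For $x>0$ let $\rho_G(x)$ be the spectral radius of the $V\times V$ matrix with entries $\sum_{e:\,i\to j}x^{\tau(e)}$. Then $\rho_G$ is differentiable with $\rho_G'>0$ on $(0,\infty)$, the limit $\alpha_G^{\mathsf{up}}=\lim_{x\to0^+}\rho_G(x)/(x\rho_G'(x))\in[0,\infty]$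 exists, and for every $v\in V$ the function $\alpha\mapsto C_{G,v}(\alpha)$ is concave on $\{\alpha\in\mathbb{R}: 0\le\alpha\le\alpha_G^{\mathsf{up}}\}$. If moreover $G$ has no cycle of cost $0$ (so that the numbers $N_{G,v}(t)$ are finite), then $C_{G,v}$ is a finite number $C_G$ that does not depend on $v$, and with $$\alpha^*=\frac{2^{C_G}}{\rho_G'(2^{-C_G})}$$ one has $0<\alpha^*\le\alpha_G^{\mathsf{up}}$ and, for every $v\in V$, $C_{G,v}(\alpha^*)=C_G=\max_{\alpha\ge0}C_{G,v}(\alpha)$. -/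

import Mathlib

open Filter Topology Set

/-- A labeled, weighted directed (multi)graph with vertices `V`, edges `E`, labels in `S` and
edge costs in `ℕ` (cost `0` is allowed). -/
structure CostGraph (V E S : Type*) where
  init : E → V
  term : E → V
  label : E → S
  cost : E → ℕ

namespace CostGraph

/-- `G.IsPath u p w`: the list of edges `p` is a path from `u` to `w`
(the empty list is the path of length zero at every vertex). -/
def IsPath {V E S : Type*} (G : CostGraph V E S) : V → List E → V → Prop
  | u, [], w => u = w
  | u, e :: p, w => G.init e = u ∧ G.IsPath (G.term e) p w

/-- The cost of a path: the sum of the costs of its edges. -/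
def pathCost {V E S : Type*} (G : CostGraph V E S) (p : List E) : ℕ := (p.map G.cost).sum

def StronglyConnected {V E S : Type*} (G : CostGraph V E S) : Prop :=
  ∀ u w : V, ∃ p : List E, G.IsPath u p w

/-- Distinct edges with the same initial vertex carry distinct labels. -/
def Deterministic {V E S : Type*} (G : CostGraph V E S) : Prop :=
  ∀ e f : E, G.init e = G.init f → G.label e = G.label f → e = f

/-- Any two paths with the same end points and the same length have the same cost. -/
def CostUniform {V E S : Type*} (G : CostGraph V E S) : Prop :=
  ∀ (u w : V) (p q : List E), G.IsPath u p w → G.IsPath u q w → p.length = q.length →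
    G.pathCost p = G.pathCost q

def CostDiverse {V E S : Type*} (G : CostGraph V E S) : Prop := ¬ G.CostUniform

/-- Every cycle (nonempty closed path) has positive cost. -/
def NoZeroCostCycle {V E S : Type*} (G : CostGraph V E S) : Prop :=
  ∀ (u : V) (p : List E), p ≠ [] → G.IsPath u p u → 0 < G.pathCost p

/-- The words generated by the paths of cost at most `t` that start in `v`. -/
def followerSet {V E S : Type*} (G : CostGraph V E S) (v : V) (t : ℕ) : Set (List S) :=
  {w | ∃ (p : List E) (u : V), G.IsPath v p u ∧ G.pathCost p ≤ t ∧ p.map G.label = w}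

/-- The words of length `n` in the cost-`t` follower set of `v`. -/
def fixedFollowerSet {V E S : Type*} (G : CostGraph V E S) (v : V) (t n : ℕ) : Set (List S) :=
  G.followerSet v t ∩ {w | w.length = n}

/-- The variable-length capacity `limsup_t log₂ N_{G,v}(t) / t`, started at `v`. It is an extended
real number, since follower sets are infinite when paths of bounded cost can run through a cycle
of cost zero. -/
noncomputable def variableCapacity {V E S : Type*} (G : CostGraph V E S) (v : V) : EReal :=
  limsup (fun t : ℕ => ENNReal.log ((G.followerSet v t).encard : ENNReal) /
    ((Real.log 2 * (t : ℝ) : ℝ) : EReal)) atTop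

/-- The fixed-length capacity `limsup_t log₂ N_{G,v}(t, ⌊α t⌋) / t`, started at `v`, with the
convention `log₂ 0 = 0`. The sequence is bounded, see `fixedRate_mem_Icc`. -/
noncomputable def fixedCapacity {V E S : Type*} (G : CostGraph V E S) (v : V) (α : ℝ) : ℝ :=
  limsup (fun t : ℕ => Real.logb 2 ((G.fixedFollowerSet v t ⌊α * t⌋₊).ncard : ℝ) / (t : ℝ)) atTop

/-- The cost-enumerator (adjacency) matrix, with entries `∑ x ^ τ(e)` over the edges `e` from
`i` to `j`. -/
def costMatrix {V E S : Type*} [DecidableEq V] [Fintype E] (G : CostGraph V E S) (x : ℂ) :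
    Matrix V V ℂ :=
  Matrix.of fun i j => ∑ e : E, if G.init e = i ∧ G.term e = j then x ^ G.cost e else 0

/-- The spectral radius `ρ_G(x)` of the cost-enumerator matrix, as a function of a real `x`. -/
noncomputable def rho {V E S : Type*} [Fintype V] [DecidableEq V] [Fintype E]
    (G : CostGraph V E S) (x : ℝ) : ℝ :=
  (spectralRadius ℂ (G.costMatrix (x : ℂ))).toReal

/-- The limit superior in `fixedCapacity` is that of a bounded sequence. -/
theorem fixedRate_mem_Icc {V E S : Type*} [Fintype E] (G : CostGraph V E S) (v : V) (α : ℝ)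
    (hα : 0 ≤ α) (t : ℕ) :
    Real.logb 2 ((G.fixedFollowerSet v t ⌊α * t⌋₊).ncard : ℝ) / (t : ℝ) ∈
      Icc 0 (α * Real.logb 2 (Fintype.card E + 1)) := by
  set n := ⌊α * t⌋₊ with hn
  have hK : 0 ≤ Real.logb 2 ((Fintype.card E : ℝ) + 1) :=
    Real.logb_nonneg one_lt_two (by linarith [Nat.cast_nonneg (α := ℝ) (Fintype.card E)])
  have hsub : G.fixedFollowerSet v t n ⊆
      Set.range (fun f : List.Vector E n => f.toList.map G.label) := by
    rintro w ⟨⟨p, u, -, -, rfl⟩, hw⟩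
    exact ⟨⟨p, by simpa using hw⟩, rfl⟩
  have hcard : (G.fixedFollowerSet v t n).ncard ≤ Fintype.card E ^ n := by
    refine (Set.ncard_le_ncard hsub (Set.finite_range _)).trans ?_
    rw [← Set.image_univ]
    refine (Set.ncard_image_le Set.finite_univ).trans ?_
    rw [Set.ncard_univ, Nat.card_eq_fintype_card, card_vector]
  have h0 : 0 ≤ Real.logb 2 ((G.fixedFollowerSet v t n).ncard : ℝ) := by
    rcases Nat.eq_zero_or_pos (G.fixedFollowerSet v t n).ncard with h | h
    · simp [h]
    · exact Real.logb_nonneg one_lt_two (by exact_mod_cast h)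
  refine ⟨div_nonneg h0 (Nat.cast_nonneg t), ?_⟩
  rcases Nat.eq_zero_or_pos t with rfl | ht
  · simpa using mul_nonneg hα hK
  have ht' : (0 : ℝ) < t := by exact_mod_cast ht
  rw [div_le_iff₀ ht']
  have hn' : (n : ℝ) ≤ α * t := Nat.floor_le (by positivity)
  have h1 : Real.logb 2 ((G.fixedFollowerSet v t n).ncard : ℝ) ≤
      n * Real.logb 2 ((Fintype.card E : ℝ) + 1) := by
    rcases Nat.eq_zero_or_pos (G.fixedFollowerSet v t n).ncard with h | h
    · simpa [h] using mul_nonneg (Nat.cast_nonneg n) hK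
    · rw [← Real.logb_pow]
      refine Real.logb_le_logb_of_le one_lt_two (by exact_mod_cast h) ?_
      calc ((G.fixedFollowerSet v t n).ncard : ℝ) ≤ (Fintype.card E : ℝ) ^ n := by
            exact_mod_cast hcard
        _ ≤ ((Fintype.card E : ℝ) + 1) ^ n := by gcongr; linarith
  nlinarith

end CostGraph

/-! Put `Λ s = log ρ(exp s)` (`logRho`) and weight a path `p` by `exp (s * cost p)`. By
Perron–Frobenius theory the total weight of the paths of length `n` from a vertex lies between
constant multiples of `exp (n * Λ s)`. In a deterministic graph words from `v` correspond to paths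
from `v`, so word counts are path counts.

Markov's inequality gives `C(α) log 2 ≤ α Λ(s) - s` for every `s ≤ 0` for which the right side is
nonnegative (the proviso reflects `log 0 = 0`). Conversely, Chernoff bounds show that the weight at
`s` sits on paths of cost about `Λ'(s) n`. Hence there are roughly `exp (n (Λ s - s Λ' s))` of
these, and for `n ≈ α t` they fit the budget `t` as soon as `α Λ'(s) < 1`. Choosing `s = 0`, or `s <
0` with `α Λ'(s)` just below `1`, makes the lower bound meet the upper one: below the critical rate,
`C(α) log 2 = inf_{s ≤ 0} (α Λ(s) - s)`. An infimum of affine functions of `α` is concave.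

Cost diversity makes `Λ` strictly convex, so `Λ'` increases strictly and `ρ/(xρ') = 1/Λ'(log x)`
increases to its supremum `αup` as `x → 0+`. Without cycles of cost zero, `Λ` has a zero `s₀ ≤ 0`.
Summing Markov's bound over the linearly many possible lengths gives capacity at most `-s₀ / log 2`,
and the tangent of `Λ` at `s₀` shows that `α* = 1/Λ'(s₀)` attains it. -/

/-! ### Perron–Frobenius theory of nonnegative irreducible matrices -/

namespace Matrix

variable {V : Type*} [Fintype V] [DecidableEq V]

/-- A nonnegative matrix any entry of which is positive in some power. -/
structure NonnegIrreducible (A : Matrix V V ℝ) : Prop where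
  nonneg : ∀ i j, 0 ≤ A i j
  exists_pow_pos : ∀ i j, ∃ k : ℕ, 0 < (A ^ k) i j

namespace NonnegIrreducible

variable {A : Matrix V V ℝ}

theorem transpose (hA : A.NonnegIrreducible) : Aᵀ.NonnegIrreducible where
  nonneg i j := hA.nonneg j i
  exists_pow_pos i j := by
    obtain ⟨k, hk⟩ := hA.exists_pow_pos j i
    exact ⟨k, by rwa [← transpose_pow]⟩

/-- A periodic matrix may have no positive power. A sum of powers still commutes with `A` and makes
nonzero nonnegative vectors positive, which is all that is used. -/
theorem exists_sum_pow_pos (hA : A.NonnegIrreducible) :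
    ∃ K : ℕ, ∀ i j, 0 < (∑ k ∈ Finset.range K, A ^ k) i j := by
  choose k hk using hA.exists_pow_pos
  refine ⟨(∑ p : V × V, k p.1 p.2) + 1, fun i j => ?_⟩
  rw [sum_apply]
  refine Finset.sum_pos' (fun l _ => pow_apply_nonneg hA.nonneg l i j) ⟨k i j, ?_, hk i j⟩
  rw [Finset.mem_range, Nat.lt_succ_iff]
  exact Finset.single_le_sum (f := fun p : V × V => k p.1 p.2) (fun _ _ => Nat.zero_le _)
    (Finset.mem_univ (i, j))

end NonnegIrreducible

theorem mulVec_pos_of_pos {V : Type*} [Fintype V] {P : Matrix V V ℝ} (hP : ∀ i j, 0 < P i j) {x : V → ℝ}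
    (hx : ∀ i, 0 ≤ x i) (hx0 : x ≠ 0) (i : V) : 0 < (P *ᵥ x) i := by
  obtain ⟨j, hj⟩ := Function.ne_iff.1 hx0
  exact Finset.sum_pos' (fun l _ => mul_nonneg (hP i l).le (hx l))
    ⟨j, Finset.mem_univ _, mul_pos (hP i j) ((hx j).lt_of_ne' hj)⟩

theorem pow_mulVec_of_eigenvector {A : Matrix V V ℝ} {r : ℝ} {u : V → ℝ} (h : A *ᵥ u = r • u)
    (k : ℕ) : (A ^ k) *ᵥ u = r ^ k • u := by
  induction k with
  | zero => simp
  | succ k ih => rw [pow_succ, ← mulVec_mulVec, h, mulVec_smul, ih, smul_smul, pow_succ']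

theorem sum_pow_mulVec_of_eigenvector {A : Matrix V V ℝ} {r : ℝ} {u : V → ℝ}
    (h : A *ᵥ u = r • u) (K : ℕ) :
    (∑ k ∈ Finset.range K, A ^ k) *ᵥ u = (∑ k ∈ Finset.range K, r ^ k) • u := by
  rw [sum_mulVec, Finset.sum_smul]
  exact Finset.sum_congr rfl fun k _ => pow_mulVec_of_eigenvector h k

namespace NonnegIrreducible

variable {A : Matrix V V ℝ}

theorem pos_of_eigenvector (hA : A.NonnegIrreducible) {r : ℝ} {u : V → ℝ}
    (h : A *ᵥ u = r • u) (hu : ∀ i, 0 ≤ u i) (hu0 : u ≠ 0) (i : V) : 0 < u i := by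
  obtain ⟨K, hK⟩ := hA.exists_sum_pow_pos
  have := mulVec_pos_of_pos hK hu hu0 i
  rw [sum_pow_mulVec_of_eigenvector h] at this
  refine (hu i).lt_of_ne' fun h0 => ?_
  simp [h0] at this

/-- **Perron's theorem**: a nonnegative irreducible matrix has a positive eigenvector. -/
theorem exists_pos_eigenvector [Nonempty V] (hA : A.NonnegIrreducible) :
    ∃ (r : ℝ) (u : V → ℝ), u ∈ stdSimplex ℝ V ∧ (∀ i, 0 < u i) ∧ A *ᵥ u = r • u := by
  set R : ℝ := ∑ i, ∑ j, A i j
  have hR : ∀ x ∈ stdSimplex ℝ V, ∀ r : ℝ, (∀ i, r * x i ≤ (A *ᵥ x) i) → r ≤ R := by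
    intro x hx r h
    calc r = ∑ i, r * x i := by rw [← Finset.mul_sum, hx.2, mul_one]
      _ ≤ ∑ i, (A *ᵥ x) i := Finset.sum_le_sum fun i _ => h i
      _ ≤ R := by
        refine Finset.sum_le_sum fun i _ => Finset.sum_le_sum fun j _ => ?_
        have : x j ≤ 1 := hx.2 ▸ Finset.single_le_sum (fun i _ => hx.1 i) (Finset.mem_univ j)
        exact mul_le_of_le_one_right (hA.nonneg i j) this
  -- Collatz–Wielandt: maximise `r` subject to `r x ≤ A x` on the simplex. The bound `R` makes the
  -- set compact.
  let T : Set ((V → ℝ) × ℝ) :=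
    (stdSimplex ℝ V ×ˢ Icc 0 R) ∩ {p | ∀ i, p.2 * p.1 i ≤ (A *ᵥ p.1) i}
  have hTc : IsCompact T := by
    refine ((isCompact_stdSimplex ℝ V).prod isCompact_Icc).inter_right ?_
    simp only [Set.ofPred_forall]
    refine isClosed_iInter fun i => isClosed_le (by fun_prop) ?_
    simp only [mulVec, dotProduct]
    fun_prop
  have hmv : ∀ x ∈ stdSimplex ℝ V, ∀ i, 0 ≤ (A *ᵥ x) i := fun x hx i =>
    Finset.sum_nonneg fun j _ => mul_nonneg (hA.nonneg i j) (hx.1 j)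
  have hTn : T.Nonempty := by
    obtain ⟨i⟩ := ‹Nonempty V›
    refine ⟨(Pi.single i 1, 0), ⟨single_mem_stdSimplex ℝ i, le_rfl, ?_⟩, fun j => ?_⟩
    · exact Finset.sum_nonneg fun i _ => Finset.sum_nonneg fun j _ => hA.nonneg i j
    · simpa using hmv _ (single_mem_stdSimplex ℝ i) j
  obtain ⟨⟨x, r⟩, ⟨⟨hx, hr⟩, hxr⟩, hmax⟩ := hTc.exists_isMaxOn hTn continuous_snd.continuousOn
  simp only at hx hr
  have hx0 : x ≠ 0 := by
    rintro rfl
    simpa using hx.2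
  obtain ⟨K, hK⟩ := hA.exists_sum_pow_pos
  set P := ∑ k ∈ Finset.range K, A ^ k with hP
  have hcomm : A * P = P * A := by
    rw [hP, Finset.mul_sum, Finset.sum_mul]
    exact Finset.sum_congr rfl fun k _ => by rw [← pow_succ, ← pow_succ']
  have heig : A *ᵥ x = r • x := by
    by_contra hne
    -- A nonzero slack `z` becomes strictly positive under `P`, so `y = P x` allows `r` to be raised
    -- by the least ratio `(P z) i / y i`, against maximality.
    set z := A *ᵥ x - r • x with hz
    have hz0 : z ≠ 0 := sub_ne_zero.2 hne
    have hzn : ∀ i, 0 ≤ z i := fun i => sub_nonneg.2 (hxr i)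
    set y := P *ᵥ x with hy
    have hypos : ∀ i, 0 < y i := mulVec_pos_of_pos hK hx.1 hx0
    have hPz : ∀ i, 0 < (P *ᵥ z) i := mulVec_pos_of_pos hK hzn hz0
    have hyz : A *ᵥ y = r • y + P *ᵥ z := by
      rw [hz, hy, mulVec_sub, mulVec_mulVec, mulVec_mulVec, hcomm, mulVec_smul]
      abel
    obtain ⟨i₀, -, hi₀⟩ := Finset.exists_min_image Finset.univ (fun i => (P *ᵥ z) i / y i)
      Finset.univ_nonempty
    set ε := (P *ᵥ z) i₀ / y i₀ with hε
    have hε0 : 0 < ε := div_pos (hPz i₀) (hypos i₀)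
    have hεy : ∀ i, (r + ε) * y i ≤ (A *ᵥ y) i := fun i => by
      have := (le_div_iff₀ (hypos i)).1 (hi₀ i (Finset.mem_univ i))
      rw [hyz]
      simp only [Pi.add_apply, Pi.smul_apply, smul_eq_mul]
      linarith
    set c := ∑ i, y i with hc
    have hc0 : 0 < c := Finset.sum_pos (fun i _ => hypos i) Finset.univ_nonempty
    have hys : c⁻¹ • y ∈ stdSimplex ℝ V := by
      refine ⟨fun i => ?_, ?_⟩
      · exact mul_nonneg (inv_nonneg.2 hc0.le) (hypos i).le
      · simp only [Pi.smul_apply, smul_eq_mul]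
        rw [← Finset.mul_sum, inv_mul_cancel₀ hc0.ne']
    have hyε : ∀ i, (r + ε) * (c⁻¹ • y) i ≤ (A *ᵥ (c⁻¹ • y)) i := fun i => by
      rw [mulVec_smul]
      simp only [Pi.smul_apply, smul_eq_mul]
      have := mul_le_mul_of_nonneg_left (hεy i) (inv_nonneg.2 hc0.le)
      linarith
    have hle : r + ε ≤ r := hmax (a := (c⁻¹ • y, r + ε))
      ⟨⟨hys, by linarith [hr.1], hR _ hys _ hyε⟩, hyε⟩
    linarith
  exact ⟨r, x, hx, hA.pos_of_eigenvector heig hx.1 hx0, heig⟩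

/-- Subtract from `u'` the largest multiple of `u` that stays below it. The difference is a
nonnegative eigenvector with a zero entry, hence zero by `pos_of_eigenvector`. -/
theorem eigenvector_unique [Nonempty V] (hA : A.NonnegIrreducible) {r : ℝ} {u u' : V → ℝ}
    (hu : ∀ i, 0 < u i) (h : A *ᵥ u = r • u) (h' : A *ᵥ u' = r • u') :
    ∃ c : ℝ, u' = c • u := by
  obtain ⟨i₀, -, hi₀⟩ := Finset.exists_min_image Finset.univ (fun i => u' i / u i)
    Finset.univ_nonempty
  set c := u' i₀ / u i₀ with hc
  refine ⟨c, ?_⟩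
  by_contra hne
  have hz : A *ᵥ (u' - c • u) = r • (u' - c • u) := by
    rw [mulVec_sub, mulVec_smul, h, h', smul_sub, smul_comm]
  have := hA.pos_of_eigenvector hz (fun i => ?_) (sub_ne_zero.2 hne) i₀
  · simp only [Pi.sub_apply, Pi.smul_apply, smul_eq_mul, hc] at this
    rw [div_mul_cancel₀ _ (hu i₀).ne', sub_self] at this
    exact lt_irrefl _ this
  · have := (le_div_iff₀ (hu i)).1 (hi₀ i (Finset.mem_univ i))
    simpa using this

end NonnegIrreducible

theorem eigenvalue_eq_of_pos {V : Type*} [Fintype V] [Nonempty V] {A : Matrix V V ℝ} {r s : ℝ} {u w : V → ℝ}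
    (hu : ∀ i, 0 < u i) (hw : ∀ i, 0 < w i) (h : A *ᵥ u = r • u) (h' : w ᵥ* A = s • w) :
    s = r := by
  have h1 : w ⬝ᵥ (A *ᵥ u) = (w ᵥ* A) ⬝ᵥ u := dotProduct_mulVec w A u
  rw [h, h', dotProduct_smul, smul_dotProduct] at h1
  have h2 : 0 < w ⬝ᵥ u := Finset.sum_pos (fun i _ => mul_pos (hw i) (hu i)) Finset.univ_nonempty
  exact (mul_right_cancel₀ h2.ne' h1).symm

theorem spectralRadius_eq_of_pos_eigenvector [Nonempty V] {A : Matrix V V ℝ}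
    (hA : ∀ i j, 0 ≤ A i j) {r : ℝ} {u : V → ℝ} (hu : ∀ i, 0 < u i) (h : A *ᵥ u = r • u) :
    (spectralRadius ℂ (A.map (algebraMap ℝ ℂ))).toReal = r := by
  have hr : 0 ≤ r := by
    obtain ⟨i⟩ := ‹Nonempty V›
    have h1 : 0 ≤ (A *ᵥ u) i := Finset.sum_nonneg fun j _ => mul_nonneg (hA i j) (hu j).le
    rw [h, Pi.smul_apply, smul_eq_mul] at h1
    exact nonneg_of_mul_nonneg_left h1 (hu i)
  have key : spectralRadius ℂ (A.map (algebraMap ℝ ℂ)) = ENNReal.ofReal r := by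
    apply le_antisymm
    · refine iSup₂_le fun μ hμ => ?_
      rw [← spectrum_toLin', ← Module.End.hasEigenvalue_iff_mem_spectrum] at hμ
      obtain ⟨z, hz⟩ := hμ.exists_hasEigenvector
      have hz1 : (A.map (algebraMap ℝ ℂ)) *ᵥ z = μ • z := by
        simpa using hz.apply_eq_smul
      -- The norm `max |z i| / u i` weighted by the positive eigenvector is the one in which `A` has
      -- norm `r`; the eigenvalue equation is read at the index that attains it.
      obtain ⟨i₀, -, hi₀⟩ := Finset.exists_max_image Finset.univ (fun i => ‖z i‖ / u i)
        Finset.univ_nonempty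
      set c := ‖z i₀‖ / u i₀ with hc
      have hle : ∀ i, ‖z i‖ ≤ c * u i := fun i =>
        (div_le_iff₀ (hu i)).1 (hi₀ i (Finset.mem_univ i))
      have hc0 : 0 < c := by
        refine (div_nonneg (norm_nonneg _) (hu i₀).le).lt_of_ne' fun h0 => hz.2 ?_
        ext i
        have := hle i
        rw [hc, h0, zero_mul] at this
        exact norm_le_zero_iff.1 this
      have h1 : ‖μ‖ * (c * u i₀) ≤ r * (c * u i₀) := by
        calc ‖μ‖ * (c * u i₀) = ‖μ‖ * ‖z i₀‖ := by rw [hc, div_mul_cancel₀ _ (hu i₀).ne']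
          _ = ‖((A.map (algebraMap ℝ ℂ)) *ᵥ z) i₀‖ := by
            rw [hz1, Pi.smul_apply, norm_smul]
          _ ≤ ∑ j, ‖(A.map (algebraMap ℝ ℂ)) i₀ j * z j‖ := norm_sum_le _ _
          _ ≤ ∑ j, A i₀ j * (c * u j) := by
            refine Finset.sum_le_sum fun j _ => ?_
            rw [norm_mul, map_apply, norm_algebraMap', Real.norm_of_nonneg (hA i₀ j)]
            exact mul_le_mul_of_nonneg_left (hle j) (hA i₀ j)
          _ = c * (A *ᵥ u) i₀ := by
            simp only [mulVec, dotProduct, Finset.mul_sum]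
            exact Finset.sum_congr rfl fun j _ => by ring
          _ = r * (c * u i₀) := by
            rw [h, Pi.smul_apply, smul_eq_mul]; ring
      have h2 : ‖μ‖ ≤ r := le_of_mul_le_mul_right h1 (mul_pos hc0 (hu i₀))
      rw [← enorm_eq_nnnorm, ← ofReal_norm]
      exact ENNReal.ofReal_le_ofReal h2
    · have hmem : (r : ℂ) ∈ spectrum ℂ (A.map (algebraMap ℝ ℂ)) := by
        rw [← spectrum_toLin', ← Module.End.hasEigenvalue_iff_mem_spectrum]
        refine Module.End.hasEigenvalue_of_hasEigenvector (x := fun i => (u i : ℂ))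
          ⟨Module.End.mem_eigenspace_iff.2 ?_, fun h0 => ?_⟩
        · ext i
          have := congrFun h i
          simp only [mulVec, dotProduct, Pi.smul_apply, smul_eq_mul] at this
          simp only [toLin'_apply, mulVec, dotProduct, map_apply, Complex.coe_algebraMap,
            Pi.smul_apply, smul_eq_mul]
          exact_mod_cast this
        · obtain ⟨i⟩ := ‹Nonempty V›
          have := congrFun h0 i
          simp [(hu i).ne'] at this
      refine le_trans (le_of_eq ?_) (le_iSup₂ (f := fun k (_ : k ∈ spectrum ℂ _) =>
        (‖k‖₊ : ENNReal)) (r : ℂ) hmem)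
      rw [← enorm_eq_nnnorm, ← ofReal_norm, Complex.norm_real, Real.norm_of_nonneg hr]
  rw [key, ENNReal.toReal_ofReal hr]

end Matrix

/-! ### Continuity and differentiability of the Perron root -/

namespace Matrix

theorem abs_dotProduct_mulVec_le {V : Type*} [Fintype V] {w u : V → ℝ} (hw : ∀ i, 0 < w i)
    (hu : u ∈ stdSimplex ℝ V) (B : Matrix V V ℝ) :
    |w ⬝ᵥ (B *ᵥ u)| ≤ ∑ i, ∑ j, w i * |B i j| := by
  refine (Finset.abs_sum_le_sum_abs _ _).trans (Finset.sum_le_sum fun i _ => ?_)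
  rw [abs_mul, abs_of_pos (hw i), ← Finset.mul_sum]
  refine mul_le_mul_of_nonneg_left ?_ (hw i).le
  refine (Finset.abs_sum_le_sum_abs _ _).trans (Finset.sum_le_sum fun j _ => ?_)
  rw [abs_mul, abs_of_nonneg (hu.1 j)]
  exact mul_le_of_le_one_right (abs_nonneg _)
    (hu.2 ▸ Finset.single_le_sum (fun i _ => hu.1 i) (Finset.mem_univ j))

/-- Pairing with the left eigenvector at the fixed point `x` gives an exact perturbation identity.
Consequently only continuity of `u`, not differentiability, is needed to differentiate `r`. -/
theorem perronRoot_sub_mul {V : Type*} [Fintype V] {A : ℝ → Matrix V V ℝ} {r : ℝ → ℝ}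
    {u : ℝ → V → ℝ} {x : ℝ} {w : V → ℝ} (hr : ∀ y, A y *ᵥ u y = r y • u y)
    (hw' : w ᵥ* A x = r x • w) (y : ℝ) :
    (r y - r x) * (w ⬝ᵥ u y) = w ⬝ᵥ ((A y - A x) *ᵥ u y) := by
  rw [sub_mulVec, dotProduct_sub, hr, dotProduct_mulVec w (A x), hw', dotProduct_smul,
    smul_dotProduct, smul_eq_mul, smul_eq_mul, sub_mul]

theorem continuousAt_perronRoot {V : Type*} [Fintype V] [Nonempty V] {A : ℝ → Matrix V V ℝ}
    {r : ℝ → ℝ} {u : ℝ → V → ℝ} {x : ℝ} {w : V → ℝ} (hAc : ContinuousAt A x)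
    (hu : ∀ y, u y ∈ stdSimplex ℝ V)
    (hr : ∀ y, A y *ᵥ u y = r y • u y) (hw : ∀ i, 0 < w i) (hw' : w ᵥ* A x = r x • w) :
    ContinuousAt r x := by
  obtain ⟨i₀, -, hi₀⟩ := Finset.exists_min_image Finset.univ w Finset.univ_nonempty
  have hlow : ∀ y, w i₀ ≤ w ⬝ᵥ u y := fun y => by
    calc w i₀ = ∑ i, w i₀ * u y i := by rw [← Finset.mul_sum, (hu y).2, mul_one]
      _ ≤ _ := Finset.sum_le_sum fun i _ =>
        mul_le_mul_of_nonneg_right (hi₀ i (Finset.mem_univ i)) ((hu y).1 i)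
  have hbound : ∀ y, |r y - r x| ≤ (∑ i, ∑ j, w i * |(A y - A x) i j|) / w i₀ := fun y => by
    rw [le_div_iff₀ (hw i₀)]
    calc |r y - r x| * w i₀ ≤ |r y - r x| * (w ⬝ᵥ u y) :=
          mul_le_mul_of_nonneg_left (hlow y) (abs_nonneg _)
      _ = |(r y - r x) * (w ⬝ᵥ u y)| := by
          rw [abs_mul, abs_of_pos ((hw i₀).trans_le (hlow y))]
      _ ≤ _ := by
          rw [perronRoot_sub_mul hr hw']
          exact abs_dotProduct_mulVec_le hw (hu y) _
  have hlim : Tendsto (fun y => (∑ i, ∑ j, w i * |(A y - A x) i j|) / w i₀) (𝓝 x) (𝓝 0) := by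
    have : ContinuousAt (fun y => (∑ i, ∑ j, w i * |(A y - A x) i j|) / w i₀) x := by
      have h : ∀ i j, ContinuousAt (fun y => A y i j) x := fun i j =>
        (continuousAt_pi.1 (continuousAt_pi.1 hAc i) j)
      simp only [sub_apply]
      fun_prop
    simpa [ContinuousAt] using this
  rw [ContinuousAt, tendsto_iff_dist_tendsto_zero]
  exact squeeze_zero (fun _ => dist_nonneg) (fun y => by rw [Real.dist_eq]; exact hbound y) hlim

section PerronFamily

variable {V : Type*} [Fintype V] [DecidableEq V] [Nonempty V] {A : ℝ → Matrix V V ℝ} {r : ℝ → ℝ}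
  {u : ℝ → V → ℝ} {x : ℝ} {w : V → ℝ}

/-- The simplex is compact, and every cluster point of `u` at `x` is an eigenvector for `r x`, so
uniqueness and normalisation force it to be `u x`. -/
theorem continuousAt_perronVector (hA : (A x).NonnegIrreducible) (hAc : ContinuousAt A x)
    (hu : ∀ y, u y ∈ stdSimplex ℝ V) (hux : ∀ i, 0 < u x i)
    (hr : ∀ y, A y *ᵥ u y = r y • u y) (hrc : ContinuousAt r x) : ContinuousAt u x := by
  refine (isCompact_stdSimplex ℝ V).tendsto_nhds_of_unique_mapClusterPt
    (Eventually.of_forall hu) fun v hv hcl => ?_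
  obtain ⟨U, hU, hUv⟩ := mapClusterPt_iff_ultrafilter.1 hcl
  have h1 : Tendsto (fun y => A y *ᵥ u y) U (𝓝 (A x *ᵥ v)) := by
    have : Continuous fun p : Matrix V V ℝ × (V → ℝ) => p.1 *ᵥ p.2 :=
      continuous_fst.matrix_mulVec continuous_snd
    exact (this.tendsto (A x, v)).comp ((hAc.mono_left hU).prodMk_nhds hUv)
  have h2 : Tendsto (fun y => r y • u y) U (𝓝 (r x • v)) := (hrc.mono_left hU).smul hUv
  have h3 : A x *ᵥ v = r x • v := tendsto_nhds_unique (h1.congr hr) h2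
  obtain ⟨c, hc⟩ := hA.eigenvector_unique hux (hr x) h3
  have h4 : c = 1 := by
    have := hv.2
    rw [hc] at this
    simpa [← Finset.mul_sum, (hu x).2] using this
  rw [hc, h4, one_smul]

/-- The Perron root of a differentiable family of nonnegative irreducible matrices is
differentiable. -/
theorem hasDerivAt_perronRoot (hA : (A x).NonnegIrreducible) {A' : Matrix V V ℝ}
    (hA' : ∀ i j, HasDerivAt (fun y => A y i j) (A' i j) x)
    (hu : ∀ y, u y ∈ stdSimplex ℝ V) (hupos : ∀ y i, 0 < u y i)
    (hr : ∀ y, A y *ᵥ u y = r y • u y) (hw : ∀ i, 0 < w i) (hw' : w ᵥ* A x = r x • w) :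
    HasDerivAt r ((w ⬝ᵥ (A' *ᵥ u x)) / (w ⬝ᵥ u x)) x := by
  have hAc : ContinuousAt A x :=
    continuousAt_pi.2 fun i => continuousAt_pi.2 fun j => (hA' i j).continuousAt
  have huc := continuousAt_perronVector hA hAc hu (hupos x) hr
    (continuousAt_perronRoot hAc hu hr hw hw')
  have hpos : ∀ y, 0 < w ⬝ᵥ u y := fun y =>
    Finset.sum_pos (fun i _ => mul_pos (hw i) (hupos y i)) Finset.univ_nonempty
  rw [hasDerivAt_iff_tendsto_slope]
  -- The perturbation identity divided by `y - x`; the limit then uses only the entrywise derivative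
  -- of `A` and the continuity of `u`.
  have hslope : ∀ y, slope r x y =
      (∑ i, w i * ∑ j, slope (fun y => A y i j) x y * u y j) / ∑ i, w i * u y i := fun y => by
    change _ = _ / (w ⬝ᵥ u y)
    rw [eq_div_iff (hpos y).ne', slope_def_field, div_mul_eq_mul_div, perronRoot_sub_mul hr hw',
      dotProduct, Finset.sum_div]
    refine Finset.sum_congr rfl fun i _ => ?_
    rw [mul_div_assoc, mulVec, dotProduct, Finset.sum_div]
    congr 1
    refine Finset.sum_congr rfl fun j _ => ?_
    rw [slope_def_field, sub_apply]
    ring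
  have hu' : ∀ i, Tendsto (fun y => u y i) (𝓝[≠] x) (𝓝 (u x i)) := fun i =>
    (continuousAt_pi.1 huc i).mono_left nhdsWithin_le_nhds
  refine Tendsto.congr (fun y => (hslope y).symm) (Tendsto.div ?_ ?_ (hpos x).ne')
  · exact tendsto_finsetSum _ fun i _ => (tendsto_finsetSum _ fun j _ =>
      (hasDerivAt_iff_tendsto_slope.1 (hA' i j)).mul (hu' j)).const_mul _
  · exact tendsto_finsetSum _ fun i _ => (hu' i).const_mul _

end PerronFamily

end Matrix

/-! ### Paths, words and costs -/

namespace CostGraph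

section Paths

variable {V E S : Type*} (G : CostGraph V E S)

theorem isPath_append {u w : V} {p q : List E} :
    G.IsPath u (p ++ q) w ↔ ∃ z, G.IsPath u p z ∧ G.IsPath z q w := by
  induction p generalizing u with
  | nil => simp [IsPath]
  | cons e p ih => simp [IsPath, ih, and_assoc]

@[simp] theorem pathCost_nil : G.pathCost [] = 0 := rfl

@[simp] theorem pathCost_cons (e : E) (p : List E) :
    G.pathCost (e :: p) = G.cost e + G.pathCost p := by simp [pathCost]

@[simp] theorem pathCost_append (p q : List E) :
    G.pathCost (p ++ q) = G.pathCost p + G.pathCost q := by simp [pathCost]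

variable {G}

theorem Deterministic.path_injective (hdet : G.Deterministic) {v w w' : V} {p q : List E}
    (hp : G.IsPath v p w) (hq : G.IsPath v q w') (h : p.map G.label = q.map G.label) : p = q := by
  induction p generalizing v q with
  | nil => exact (List.map_eq_nil_iff.1 h.symm).symm
  | cons e p ih =>
    cases q with
    | nil => simp at h
    | cons f q =>
      simp only [List.map_cons, List.cons.injEq] at h
      obtain rfl := hdet e f (hp.1.trans hq.1.symm) h.1
      rw [ih hp.2 hq.2 h.2]

theorem CostDiverse.nonempty (hdiv : G.CostDiverse) : Nonempty V := by
  by_contra h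
  exact hdiv fun u => (h ⟨u⟩).elim

theorem CostDiverse.exists_cost_pos (hdiv : G.CostDiverse) : ∃ e, 0 < G.cost e := by
  by_contra! h
  have h0 : ∀ p, G.pathCost p = 0 := fun p => by
    induction p with
    | nil => rfl
    | cons e p ih => rw [pathCost_cons, ih, Nat.le_zero.1 (h e)]
  exact hdiv fun _ _ p q _ _ _ => by rw [h0, h0]

/-- If the edge costs are, up to a coboundary, proportional to a constant, then the graph is
cost-uniform. -/
theorem costUniform_of_coboundary {a b : ℝ} (ha : a ≠ 0) (f : V → ℝ)
    (h : ∀ e, a * G.cost e = b + f (G.init e) - f (G.term e)) : G.CostUniform := by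
  have key : ∀ (p : List E) (u w : V), G.IsPath u p w →
      a * G.pathCost p = b * p.length + f u - f w := by
    intro p
    induction p with
    | nil => rintro u w rfl; simp
    | cons e p ih =>
      rintro u w ⟨rfl, hp⟩
      have h1 := ih _ _ hp
      have h2 := h e
      rw [pathCost_cons, List.length_cons]
      push_cast
      linarith
  intro u w p q hp hq hl
  have h1 := key p u w hp
  rw [hl, ← key q u w hq] at h1
  exact_mod_cast mul_left_cancel₀ ha h1

/-- Along a path of cost zero no initial vertex repeats, since a repetition would enclose a cycle of
cost zero; pigeonhole bounds the length. -/
theorem IsPath.pathCost_pos_of_card_lt [Fintype V] (hz : G.NoZeroCostCycle) {u w : V}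
    {p : List E} (hp : G.IsPath u p w) (hl : Fintype.card V < p.length) : 0 < G.pathCost p := by
  by_contra! h0
  have key : ∀ (p : List E) (u : V), G.IsPath u p w → G.pathCost p = 0 →
      (p.map G.init).Nodup := by
    intro p
    induction p with
    | nil => simp
    | cons e p ih =>
      rintro u ⟨rfl, hp⟩ h0
      rw [pathCost_cons, Nat.add_eq_zero_iff] at h0
      rw [List.map_cons, List.nodup_cons]
      refine ⟨fun hmem => ?_, ih _ hp h0.2⟩
      obtain ⟨f, hf, hfe⟩ := List.mem_map.1 hmem
      obtain ⟨a, b, rfl⟩ := List.append_of_mem hf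
      obtain ⟨z, hz1, hz2, -⟩ := G.isPath_append.1 hp
      have hc := hz (G.init e) (e :: a) (List.cons_ne_nil _ _)
        ⟨rfl, by rwa [← hfe, hz2]⟩
      have h1 := h0.2
      rw [pathCost_append] at h1
      rw [pathCost_cons] at hc
      omega
  have := (key p u hp (Nat.le_zero.1 h0)).length_le_card
  rw [List.length_map] at this
  omega

theorem IsPath.le_pathCost [Fintype V] (hz : G.NoZeroCostCycle) (k : ℕ) {u w : V} {p : List E}
    (hp : G.IsPath u p w) (hl : k * (Fintype.card V + 1) ≤ p.length) : k ≤ G.pathCost p := by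
  induction k generalizing u p with
  | zero => exact Nat.zero_le _
  | succ k ih =>
    rw [Nat.succ_mul] at hl
    rw [← List.take_append_drop (Fintype.card V + 1) p] at hp ⊢
    obtain ⟨z, h1, h2⟩ := G.isPath_append.1 hp
    have h3 := h1.pathCost_pos_of_card_lt hz (by rw [List.length_take]; omega)
    have h4 := ih h2 (by rw [List.length_drop]; omega)
    rw [pathCost_append]
    omega

end Paths

section PathsFrom

variable {V E S : Type*} [Fintype E] (G : CostGraph V E S)

open Classical in
/-- The finite set of paths of length `n` that start in `v`. -/
noncomputable def pathsFrom : ℕ → V → Finset (List E)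
  | 0, _ => {[]}
  | n + 1, v => (Finset.univ.filter fun e => G.init e = v).biUnion fun e =>
      (pathsFrom n (G.term e)).image (List.cons e)

variable {G}

theorem mem_pathsFrom {n : ℕ} {v : V} {p : List E} :
    p ∈ G.pathsFrom n v ↔ p.length = n ∧ ∃ w, G.IsPath v p w := by
  induction n generalizing v p with
  | zero =>
    simp only [pathsFrom, Finset.mem_singleton, List.length_eq_zero_iff]
    exact ⟨fun h => ⟨h, v, by rw [h]; rfl⟩, fun h => h.1⟩
  | succ n ih =>
    simp only [pathsFrom, Finset.mem_biUnion, Finset.mem_filter, Finset.mem_univ, true_and,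
      Finset.mem_image, ih]
    constructor
    · rintro ⟨e, rfl, q, ⟨rfl, w, hw⟩, rfl⟩
      exact ⟨rfl, w, rfl, hw⟩
    · rintro ⟨hl, w, hw⟩
      cases p with
      | nil => simp at hl
      | cons e q =>
        exact ⟨e, hw.1, q, ⟨by simpa using hl, w, hw.2⟩, rfl⟩

open Classical in
theorem sum_pathsFrom_succ (n : ℕ) (v : V) (f : List E → ℝ) :
    ∑ p ∈ G.pathsFrom (n + 1) v, f p =
      ∑ e with G.init e = v, ∑ p ∈ G.pathsFrom n (G.term e), f (e :: p) := by
  rw [pathsFrom, Finset.sum_biUnion]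
  · refine Finset.sum_congr rfl fun e _ => Finset.sum_image ?_
    intro p _ q _ h
    exact (List.cons.inj h).2
  · intro e _ f _ hef
    rw [Function.onFun, Finset.disjoint_left]
    rintro p hp hq
    obtain ⟨a, -, rfl⟩ := Finset.mem_image.1 hp
    obtain ⟨b, -, h⟩ := Finset.mem_image.1 hq
    exact hef (List.cons.inj h).1.symm

variable (G) in
/-- The generating function of the costs of the paths of length `n` from `v`, at `exp s`. -/
noncomputable def pathSum (s : ℝ) (n : ℕ) (v : V) : ℝ :=
  ∑ p ∈ G.pathsFrom n v, Real.exp (s * G.pathCost p)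

variable (G) in
/-- The number of paths of length `n` and cost at most `t` from `v`. -/
noncomputable def pathCount (v : V) (t n : ℕ) : ℕ :=
  ((G.pathsFrom n v).filter fun p => G.pathCost p ≤ t).card

theorem fixedFollowerSet_eq (v : V) (t n : ℕ) : G.fixedFollowerSet v t n =
    (List.map G.label) '' (((G.pathsFrom n v).filter fun p => G.pathCost p ≤ t : Finset (List E)) :
      Set (List E)) := by
  ext w
  simp only [fixedFollowerSet, followerSet, mem_inter_iff, mem_ofPred_eq, mem_image,
    Finset.coe_filter, mem_pathsFrom]
  constructor
  · rintro ⟨⟨p, u, hp, hc, rfl⟩, hl⟩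
    exact ⟨p, ⟨⟨by simpa using hl, u, hp⟩, hc⟩, rfl⟩
  · rintro ⟨p, ⟨⟨hl, u, hp⟩, hc⟩, rfl⟩
    exact ⟨⟨p, u, hp, hc, rfl⟩, by simpa using hl⟩

theorem Deterministic.ncard_fixedFollowerSet (hdet : G.Deterministic) (v : V) (t n : ℕ) :
    (G.fixedFollowerSet v t n).ncard = G.pathCount v t n := by
  rw [fixedFollowerSet_eq, InjOn.ncard_image, ncard_coe_finset, pathCount]
  intro p hp q hq h
  simp only [Finset.coe_filter, mem_ofPred_eq, mem_pathsFrom] at hp hq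
  obtain ⟨⟨-, w, hw⟩, -⟩ := hp
  obtain ⟨⟨-, w', hw'⟩, -⟩ := hq
  exact hdet.path_injective hw hw' h

theorem finite_fixedFollowerSet (v : V) (t n : ℕ) : (G.fixedFollowerSet v t n).Finite := by
  rw [fixedFollowerSet_eq]
  exact (Finset.finite_toSet _).image _

/-- Markov's inequality for the number of paths of cost at most `t`. -/
theorem pathCount_le_exp_mul_pathSum {s : ℝ} (hs : s ≤ 0) (v : V) (t n : ℕ) :
    (G.pathCount v t n : ℝ) ≤ Real.exp (-(s * t)) * G.pathSum s n v := by
  rw [pathCount, Finset.card_eq_sum_ones, Nat.cast_sum, pathSum, Finset.mul_sum]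
  refine (Finset.sum_le_sum fun p hp => ?_).trans
    (Finset.sum_le_sum_of_subset_of_nonneg (Finset.filter_subset _ _) fun _ _ _ => by positivity)
  rw [← Real.exp_add, Nat.cast_one, Real.one_le_exp_iff]
  have h1 : (G.pathCost p : ℝ) ≤ t := by exact_mod_cast (Finset.mem_filter.1 hp).2
  nlinarith

end PathsFrom

end CostGraph

/-! ### The cost-enumerator matrix and the logarithmic Perron root -/

namespace CostGraph

open Matrix

variable {V E S : Type*} [DecidableEq V] [Fintype E] (G : CostGraph V E S)

/-- The cost-enumerator matrix at `exp s`, with real entries. -/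
noncomputable def expMatrix (s : ℝ) : Matrix V V ℝ :=
  of fun i j => ∑ e : E, if G.init e = i ∧ G.term e = j then Real.exp (s * G.cost e) else 0

/-- The entrywise derivative of `expMatrix`. -/
noncomputable def expMatrixDeriv (s : ℝ) : Matrix V V ℝ :=
  of fun i j => ∑ e : E, if G.init e = i ∧ G.term e = j then
    Real.exp (s * G.cost e) * G.cost e else 0

theorem costMatrix_exp (s : ℝ) :
    G.costMatrix ((Real.exp s : ℝ) : ℂ) = (G.expMatrix s).map (algebraMap ℝ ℂ) := by
  ext i j
  simp only [costMatrix, expMatrix, of_apply, map_apply, map_sum]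
  refine Finset.sum_congr rfl fun e _ => ?_
  split_ifs
  · rw [Complex.coe_algebraMap, ← Complex.ofReal_pow, ← Real.exp_nat_mul, mul_comm]
  · simp

theorem expMatrix_nonneg (s : ℝ) (i j : V) : 0 ≤ G.expMatrix s i j :=
  Finset.sum_nonneg fun e _ => by split_ifs <;> positivity

theorem expMatrix_pos (s : ℝ) (e : E) : 0 < G.expMatrix s (G.init e) (G.term e) := by
  refine Finset.sum_pos' (fun e _ => by split_ifs <;> positivity) ⟨e, Finset.mem_univ e, ?_⟩
  rw [if_pos ⟨rfl, rfl⟩]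
  positivity

theorem hasDerivAt_expMatrix (s : ℝ) (i j : V) :
    HasDerivAt (fun t => G.expMatrix t i j) (G.expMatrixDeriv s i j) s := by
  simp only [expMatrix, expMatrixDeriv, of_apply]
  refine HasDerivAt.fun_sum fun e _ => ?_
  split_ifs
  · simpa using ((hasDerivAt_id s).mul_const (G.cost e : ℝ)).exp
  · exact hasDerivAt_const s 0

theorem pathSum_succ (s : ℝ) (n : ℕ) (v : V) : G.pathSum s (n + 1) v =
    ∑ e with G.init e = v, Real.exp (s * G.cost e) * G.pathSum s n (G.term e) := by
  classical
  rw [pathSum, sum_pathsFrom_succ]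
  refine Finset.sum_congr (by congr) fun e _ => ?_
  rw [pathSum, Finset.mul_sum]
  refine Finset.sum_congr rfl fun p _ => ?_
  rw [← Real.exp_add, pathCost_cons]
  push_cast
  ring_nf

variable [Fintype V]

/-- The logarithm of the Perron root at `exp s`. -/
noncomputable def logRho (s : ℝ) : ℝ := Real.log (G.rho (Real.exp s))

theorem of_sum_mulVec (f : E → ℝ) (u : V → ℝ) (i : V) :
    ((of fun i j => ∑ e : E, if G.init e = i ∧ G.term e = j then f e else 0) *ᵥ u) i =
      ∑ e with G.init e = i, f e * u (G.term e) := by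
  simp only [mulVec, dotProduct, of_apply, Finset.sum_mul]
  rw [Finset.sum_comm, Finset.sum_filter]
  refine Finset.sum_congr rfl fun e _ => ?_
  by_cases h : G.init e = i
  · simp [h]
  · simp [h]

theorem expMatrix_mulVec (s : ℝ) (u : V → ℝ) (i : V) :
    (G.expMatrix s *ᵥ u) i = ∑ e with G.init e = i, Real.exp (s * G.cost e) * u (G.term e) :=
  G.of_sum_mulVec _ u i

variable {G}

theorem StronglyConnected.expMatrix_irreducible (hconn : G.StronglyConnected) (s : ℝ) :
    (G.expMatrix s).NonnegIrreducible where
  nonneg := G.expMatrix_nonneg s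
  exists_pow_pos i j := by
    obtain ⟨p, hp⟩ := hconn i j
    refine ⟨p.length, ?_⟩
    induction p generalizing i with
    | nil => obtain rfl : i = j := hp; simp
    | cons e p ih =>
      obtain ⟨rfl, hp⟩ := hp
      rw [List.length_cons, pow_succ', mul_apply]
      exact Finset.sum_pos' (fun l _ => mul_nonneg (G.expMatrix_nonneg s _ _) (pow_apply_nonneg (G.expMatrix_nonneg s) _ _ _))
        ⟨G.term e, Finset.mem_univ _, mul_pos (G.expMatrix_pos s e) (ih _ hp)⟩

theorem StronglyConnected.exists_rightVec [Nonempty V] (hconn : G.StronglyConnected) (s : ℝ) :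
    ∃ u ∈ stdSimplex ℝ V, (∀ i, 0 < u i) ∧
      G.expMatrix s *ᵥ u = G.rho (Real.exp s) • u := by
  obtain ⟨r, u, hu, hpos, h⟩ := (hconn.expMatrix_irreducible s).exists_pos_eigenvector
  refine ⟨u, hu, hpos, ?_⟩
  rw [rho, costMatrix_exp, spectralRadius_eq_of_pos_eigenvector (G.expMatrix_nonneg s) hpos h, h]

theorem StronglyConnected.exists_leftVec [Nonempty V] (hconn : G.StronglyConnected) (s : ℝ) :
    ∃ w : V → ℝ, (∀ i, 0 < w i) ∧ w ᵥ* G.expMatrix s = G.rho (Real.exp s) • w := by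
  obtain ⟨r, w, -, hpos, h⟩ := (hconn.expMatrix_irreducible s).transpose.exists_pos_eigenvector
  rw [mulVec_transpose] at h
  obtain ⟨u, -, hu, hu'⟩ := hconn.exists_rightVec s
  refine ⟨w, hpos, ?_⟩
  rw [h, eigenvalue_eq_of_pos hu hpos hu' h]

/-- The derivative is `w A' u / (w u)` with positive Perron vectors, and an edge of positive cost
makes `A'` nonzero. -/
theorem StronglyConnected.exists_hasDerivAt_rho_exp (hconn : G.StronglyConnected)
    (hcost : ∃ e, 0 < G.cost e) (s : ℝ) :
    ∃ d, 0 < d ∧ HasDerivAt (fun t => G.rho (Real.exp t)) d s := by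
  obtain ⟨e, he⟩ := hcost
  have : Nonempty V := ⟨G.init e⟩
  choose u hu hpos h using hconn.exists_rightVec
  obtain ⟨w, hw, hw'⟩ := hconn.exists_leftVec s
  refine ⟨_, ?_, hasDerivAt_perronRoot (hconn.expMatrix_irreducible s)
    (G.hasDerivAt_expMatrix s) hu hpos h hw hw'⟩
  have hnn : ∀ i, 0 ≤ (G.expMatrixDeriv s *ᵥ u s) i := fun i => by
    rw [expMatrixDeriv, of_sum_mulVec]
    exact Finset.sum_nonneg fun f _ => by have := hpos s (G.term f); positivity
  refine div_pos (Finset.sum_pos' (fun i _ => mul_nonneg (hw i).le (hnn i))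
    ⟨G.init e, Finset.mem_univ _, mul_pos (hw _) ?_⟩)
    (Finset.sum_pos (fun i _ => mul_pos (hw i) (hpos s i)) Finset.univ_nonempty)
  rw [expMatrixDeriv, of_sum_mulVec]
  have := hpos s (G.term e)
  exact Finset.sum_pos' (fun f _ => by have := hpos s (G.term f); positivity)
    ⟨e, by simp, by positivity⟩

theorem StronglyConnected.rho_exp_pos (hconn : G.StronglyConnected) [Nonempty E] (s : ℝ) :
    0 < G.rho (Real.exp s) := by
  obtain ⟨e⟩ := ‹Nonempty E›
  have : Nonempty V := ⟨G.init e⟩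
  obtain ⟨u, -, hpos, h⟩ := hconn.exists_rightVec s
  have h1 : 0 < (G.expMatrix s *ᵥ u) (G.init e) :=
    Finset.sum_pos' (fun j _ => mul_nonneg (G.expMatrix_nonneg s _ _) (hpos j).le)
      ⟨G.term e, Finset.mem_univ _, mul_pos (G.expMatrix_pos s e) (hpos _)⟩
  rw [h, Pi.smul_apply, smul_eq_mul] at h1
  exact pos_of_mul_pos_left h1 (hpos _).le

theorem StronglyConnected.exp_logRho (hconn : G.StronglyConnected) [Nonempty E] (s : ℝ) :
    Real.exp (G.logRho s) = G.rho (Real.exp s) := Real.exp_log (hconn.rho_exp_pos s)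

theorem StronglyConnected.exists_hasDerivAt_logRho (hconn : G.StronglyConnected)
    (hcost : ∃ e, 0 < G.cost e) (s : ℝ) : ∃ d, 0 < d ∧ HasDerivAt G.logRho d s := by
  have : Nonempty E := ⟨hcost.choose⟩
  obtain ⟨d, hd, h⟩ := hconn.exists_hasDerivAt_rho_exp hcost s
  exact ⟨_, div_pos hd (hconn.rho_exp_pos s), h.log (hconn.rho_exp_pos s).ne'⟩

/-- In this form `x ρ'(x) / ρ(x) = Λ'(log x)`, which transfers monotonicity of `Λ'` to the ratio
that defines `αup`. -/
theorem StronglyConnected.hasDerivAt_rho (hconn : G.StronglyConnected)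
    (hcost : ∃ e, 0 < G.cost e) {x : ℝ} (hx : 0 < x) :
    HasDerivAt G.rho (G.rho x * deriv G.logRho (Real.log x) / x) x := by
  have : Nonempty E := ⟨hcost.choose⟩
  obtain ⟨d, hd, h⟩ := hconn.exists_hasDerivAt_rho_exp hcost (Real.log x)
  have h1 : deriv G.logRho (Real.log x) = d / G.rho x := by
    change deriv (fun y => Real.log (G.rho (Real.exp y))) _ = _
    rw [(h.log (hconn.rho_exp_pos _).ne').deriv, Real.exp_log hx]
  have hx' : 0 < G.rho x := by simpa [Real.exp_log hx] using hconn.rho_exp_pos (Real.log x)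
  have h2 : HasDerivAt (fun y => G.rho (Real.exp (Real.log y))) (d * x⁻¹) x :=
    h.comp x (Real.hasDerivAt_log hx.ne')
  rw [h1, mul_div_cancel₀ _ hx'.ne', div_eq_mul_inv]
  refine h2.congr_of_eventuallyEq ?_
  filter_upwards [lt_mem_nhds hx] with y hy
  rw [Real.exp_log hy]

/-- The logarithmic Perron root of a cost-diverse graph is strictly convex. -/
theorem StronglyConnected.strictConvexOn_logRho (hconn : G.StronglyConnected)
    (hdiv : G.CostDiverse) : StrictConvexOn ℝ univ G.logRho := by
  have : Nonempty E := ⟨hdiv.exists_cost_pos.choose⟩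
  have : Nonempty V := hdiv.nonempty
  refine ⟨convex_univ, fun s _ t _ hst a b ha hb hab => ?_⟩
  obtain ⟨u, -, hu, hus⟩ := hconn.exists_rightVec s
  obtain ⟨v, -, hv, hvt⟩ := hconn.exists_rightVec t
  simp only [smul_eq_mul]
  set z := a * s + b * t with hz
  set Λ := a * G.logRho s + b * G.logRho t with hΛ
  obtain ⟨w, hw, hwz⟩ := hconn.exists_leftVec z
  -- The exponential of `H` is a weighted geometric mean of the two eigenvectors. It will be a
  -- strict supersolution at `z`. The functions `P` and `Q` below are logarithms of the transition
  -- probabilities of the Markov chains at `s` and `t`.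
  set H : V → ℝ := fun i => a * Real.log (u i) + b * Real.log (v i) with hH
  let P : E → ℝ := fun e => s * G.cost e + Real.log (u (G.term e)) - G.logRho s -
    Real.log (u (G.init e))
  let Q : E → ℝ := fun e => t * G.cost e + Real.log (v (G.term e)) - G.logRho t -
    Real.log (v (G.init e))
  have hsum : ∀ (s : ℝ) (u : V → ℝ), (∀ i, 0 < u i) →
      G.expMatrix s *ᵥ u = G.rho (Real.exp s) • u → ∀ i, ∑ e with G.init e = i,
        Real.exp (s * G.cost e + Real.log (u (G.term e)) - G.logRho s -
          Real.log (u (G.init e))) = 1 := by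
    intro s u hu hus i
    have h1 := congrFun hus i
    rw [expMatrix_mulVec, Pi.smul_apply, smul_eq_mul, ← hconn.exp_logRho] at h1
    have h2 : ∀ e ∈ Finset.univ.filter (fun e => G.init e = i),
        Real.exp (s * G.cost e + Real.log (u (G.term e)) - G.logRho s -
          Real.log (u (G.init e))) =
        Real.exp (s * G.cost e) * u (G.term e) / (Real.exp (G.logRho s) * u i) := by
      intro e he
      rw [(Finset.mem_filter.1 he).2, Real.exp_sub, Real.exp_sub, Real.exp_add,
        Real.exp_log (hu _), Real.exp_log (hu _), div_div]
    rw [Finset.sum_congr rfl h2, ← Finset.sum_div, h1, div_self]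
    exact (mul_pos (Real.exp_pos _) (hu i)).ne'
  have hP := hsum s u hu hus
  have hQ := hsum t v hv hvt
  -- Equal transition probabilities would make `(s - t)` times the cost a constant plus a
  -- coboundary, so the graph would be cost-uniform.
  have hPQ : ∃ e, P e ≠ Q e := by
    by_contra! hcon
    refine hdiv (costUniform_of_coboundary (a := s - t) (b := G.logRho s - G.logRho t)
      (sub_ne_zero.2 hst) (fun i => Real.log (u i) - Real.log (v i)) fun e => ?_)
    have := hcon e
    simp only [P, Q] at this
    linarith
  have hle : ∀ e, Real.exp (a * P e + b * Q e) ≤ a * Real.exp (P e) + b * Real.exp (Q e) :=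
    fun e => convexOn_exp.2 (mem_univ _) (mem_univ _) ha.le hb.le hab
  have hrow : ∀ i, ∑ e with G.init e = i, (a * Real.exp (P e) + b * Real.exp (Q e)) = 1 :=
    fun i => by rw [Finset.sum_add_distrib, ← Finset.mul_sum, ← Finset.mul_sum, hP, hQ]; linarith
  have hMh : ∀ i, (G.expMatrix z *ᵥ fun j => Real.exp (H j)) i =
      (∑ e with G.init e = i, Real.exp (a * P e + b * Q e)) *
        (Real.exp Λ * Real.exp (H i)) := by
    intro i
    rw [expMatrix_mulVec, Finset.sum_mul]
    refine Finset.sum_congr rfl fun e he => ?_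
    rw [← (Finset.mem_filter.1 he).2, ← Real.exp_add, ← Real.exp_add, ← Real.exp_add]
    congr 1
    simp only [P, Q, hH, hz, hΛ]
    ring
  have hpos : ∀ i, 0 < Real.exp Λ * Real.exp (H i) := fun i => by positivity
  -- Convexity of `exp` bounds each row factor by `1`, strictly at the initial vertex of an edge
  -- where `P` and `Q` differ. Pairing with the positive left eigenvector turns this into a strict
  -- inequality of Perron roots.
  have hlt : w ⬝ᵥ (G.expMatrix z *ᵥ fun j => Real.exp (H j)) <
      ∑ i, w i * (Real.exp Λ * Real.exp (H i)) := by
    obtain ⟨e, he⟩ := hPQ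
    refine Finset.sum_lt_sum (fun i _ => ?_) ⟨G.init e, Finset.mem_univ _, ?_⟩
    · rw [hMh]
      refine mul_le_mul_of_nonneg_left (mul_le_of_le_one_left (hpos i).le ?_) (hw i).le
      exact (Finset.sum_le_sum fun e _ => hle e).trans_eq (hrow i)
    · rw [hMh]
      refine mul_lt_mul_of_pos_left (mul_lt_of_lt_one_left (hpos _) ?_) (hw _)
      rw [← hrow (G.init e)]
      exact Finset.sum_lt_sum (fun e _ => hle e) ⟨e, by simp,
        strictConvexOn_exp.2 (mem_univ _) (mem_univ _) he ha hb hab⟩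
  have hfac : ∑ i, w i * (Real.exp Λ * Real.exp (H i)) =
      Real.exp Λ * (w ⬝ᵥ fun j => Real.exp (H j)) := by
    rw [dotProduct, Finset.mul_sum]
    exact Finset.sum_congr rfl fun i _ => by ring
  rw [dotProduct_mulVec, hwz, smul_dotProduct, smul_eq_mul, hfac, ← hconn.exp_logRho] at hlt
  have hwH : 0 < w ⬝ᵥ fun j => Real.exp (H j) :=
    Finset.sum_pos (fun i _ => mul_pos (hw i) (Real.exp_pos _)) Finset.univ_nonempty
  exact Real.exp_lt_exp.1 (lt_of_mul_lt_mul_right hlt hwH.le)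

/-- The generating functions `pathSum s n` grow like the powers of the Perron root. -/
theorem StronglyConnected.exists_pathSum_bounds (hconn : G.StronglyConnected) [Nonempty E]
    (s : ℝ) : ∃ a b : ℝ, 0 < a ∧ 0 < b ∧ ∀ (n : ℕ) v,
      a * Real.exp (n * G.logRho s) ≤ G.pathSum s n v ∧
      G.pathSum s n v ≤ b * Real.exp (n * G.logRho s) := by
  have : Nonempty V := ‹Nonempty E›.map G.init
  obtain ⟨u, hus, hu, h⟩ := hconn.exists_rightVec s
  obtain ⟨i₀, -, hi₀⟩ := Finset.exists_min_image Finset.univ u Finset.univ_nonempty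
  have hu1 : ∀ i, u i ≤ 1 := fun i =>
    hus.2 ▸ Finset.single_le_sum (fun i _ => hus.1 i) (Finset.mem_univ i)
  have hstep : ∀ v, ∑ e with G.init e = v, Real.exp (s * G.cost e) * u (G.term e) =
      Real.exp (G.logRho s) * u v := fun v => by
    rw [← expMatrix_mulVec, h, hconn.exp_logRho, Pi.smul_apply, smul_eq_mul]
  -- Start from `u v ≤ 1 ≤ u v / u i₀` and apply the nonnegative matrix `n` times.
  have key : ∀ (n : ℕ) v, Real.exp (n * G.logRho s) * u v ≤ G.pathSum s n v ∧
      G.pathSum s n v * u i₀ ≤ Real.exp (n * G.logRho s) * u v := by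
    intro n
    induction n with
    | zero =>
      intro v
      simpa [pathSum, pathsFrom] using ⟨hu1 v, hi₀ v (Finset.mem_univ v)⟩
    | succ n ih =>
      intro v
      have h1 : Real.exp ((n + 1 : ℕ) * G.logRho s) * u v =
          ∑ e with G.init e = v, Real.exp (s * G.cost e) *
            (Real.exp (n * G.logRho s) * u (G.term e)) := by
        rw [Nat.cast_succ, add_mul, one_mul, Real.exp_add, mul_assoc, ← hstep, Finset.mul_sum]
        exact Finset.sum_congr rfl fun e _ => by ring
      rw [h1, pathSum_succ, Finset.sum_mul]
      refine ⟨Finset.sum_le_sum fun e _ => ?_, Finset.sum_le_sum fun e _ => ?_⟩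
      · exact mul_le_mul_of_nonneg_left (ih _).1 (Real.exp_pos _).le
      · rw [mul_assoc]
        exact mul_le_mul_of_nonneg_left (ih _).2 (Real.exp_pos _).le
  refine ⟨u i₀, (u i₀)⁻¹, hu i₀, inv_pos.2 (hu i₀), fun n v => ⟨?_, ?_⟩⟩
  · rw [mul_comm]
    exact (mul_le_mul_of_nonneg_left (hi₀ v (Finset.mem_univ v)) (Real.exp_pos _).le).trans
      (key n v).1
  · rw [inv_mul_eq_div, le_div_iff₀ (hu i₀)]
    exact (key n v).2.trans (mul_le_of_le_one_right (Real.exp_pos _).le (hu1 v))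

end CostGraph

/-! ### Large deviations: exponential bounds for the number of paths -/

theorem le_of_eventually_natCast_mul_le {x y c : ℝ} (h : ∀ᶠ n : ℕ in atTop, n * x ≤ c + n * y) :
    x ≤ y := by
  by_contra! hlt
  have h1 : Tendsto (fun n : ℕ => (n : ℝ) * (x - y)) atTop atTop :=
    tendsto_natCast_atTop_atTop.atTop_mul_const (sub_pos.2 hlt)
  obtain ⟨n, hn, hn'⟩ := (h.and (h1.eventually_gt_atTop c)).exists
  linarith

theorem tendsto_add_floor_mul_add_mul_div {α : ℝ} (hα : 0 ≤ α) (c x y : ℝ) :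
    Tendsto (fun t : ℕ => (c + (⌊α * t⌋₊ : ℝ) * x + y * t) / t) atTop (𝓝 (α * x + y)) := by
  have h1 : Tendsto (fun t : ℕ => (⌊α * t⌋₊ : ℝ) / t) atTop (𝓝 α) :=
    (tendsto_nat_floor_mul_div_atTop hα).comp tendsto_natCast_atTop_atTop
  have h2 : Tendsto (fun t : ℕ => c / (t : ℝ)) atTop (𝓝 0) := tendsto_const_div_atTop_nhds_zero_nat c
  have h3 := (h2.add (h1.mul_const x)).add_const y
  rw [zero_add] at h3
  refine h3.congr' ?_
  filter_upwards [eventually_gt_atTop 0] with t ht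
  have : (t : ℝ) ≠ 0 := by positivity
  field_simp

namespace CostGraph

variable {V E S : Type*} [Fintype V] [DecidableEq V] [Fintype E] {G : CostGraph V E S}

section Chernoff

variable [Nonempty E] {s d : ℝ}

/-- Chernoff's bound for the costs of the paths of length `n`. -/
theorem StronglyConnected.eventually_tail_le (hconn : G.StronglyConnected) {δ θ : ℝ}
    (h : G.logRho (s + δ) - G.logRho s - δ * θ < 0) {c : ℝ} (hc : 0 < c) :
    ∀ᶠ n : ℕ in atTop, ∀ v, ∑ p ∈ G.pathsFrom n v with δ * (θ * n) ≤ δ * G.pathCost p,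
      Real.exp (s * G.pathCost p) ≤ c * Real.exp (n * G.logRho s) := by
  obtain ⟨_, b, _, hb, hab⟩ := hconn.exists_pathSum_bounds (s + δ)
  -- The sign of `δ` selects the upper or the lower tail. On the tail `exp (δ (cost - θ n)) ≥ 1`,
  -- which tilts the weight from `s` to `s + δ` at exponential rate `η < 0`.
  set η := G.logRho (s + δ) - G.logRho s - δ * θ
  have h1 : Tendsto (fun n : ℕ => b * Real.exp (n * η)) atTop (𝓝 (b * 0)) :=
    (Real.tendsto_exp_atBot.comp
      (tendsto_natCast_atTop_atTop.atTop_mul_const_of_neg h)).const_mul b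
  rw [mul_zero] at h1
  filter_upwards [h1.eventually_le_const hc] with n hn v
  calc ∑ p ∈ G.pathsFrom n v with δ * (θ * n) ≤ δ * G.pathCost p, Real.exp (s * G.pathCost p)
      ≤ ∑ p ∈ G.pathsFrom n v with δ * (θ * n) ≤ δ * G.pathCost p,
          Real.exp (-(δ * (θ * n))) * Real.exp ((s + δ) * G.pathCost p) := by
        refine Finset.sum_le_sum fun p hp => ?_
        rw [← Real.exp_add, Real.exp_le_exp]
        linarith [(Finset.mem_filter.1 hp).2]
    _ ≤ Real.exp (-(δ * (θ * n))) * G.pathSum (s + δ) n v := by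
        rw [pathSum, Finset.mul_sum]
        exact Finset.sum_le_sum_of_subset_of_nonneg (Finset.filter_subset _ _)
          fun _ _ _ => by positivity
    _ ≤ Real.exp (-(δ * (θ * n))) * (b * Real.exp (n * G.logRho (s + δ))) :=
        mul_le_mul_of_nonneg_left (hab n v).2 (Real.exp_pos _).le
    _ = b * Real.exp (n * η) * Real.exp (n * G.logRho s) := by
        rw [mul_left_comm, mul_assoc, ← Real.exp_add, ← Real.exp_add]
        congr 2
        ring
    _ ≤ _ := mul_le_mul_of_nonneg_right hn (Real.exp_pos _).le

/-- At `exp s`, the generating function of the costs of the paths of length `n` is concentrated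
on the costs near `d * n`, where `d` is the logarithmic derivative of the Perron root. -/
theorem StronglyConnected.eventually_le_window (hconn : G.StronglyConnected)
    (hd : HasDerivAt G.logRho d s) {ε : ℝ} (hε : 0 < ε) :
    ∃ a > 0, ∀ᶠ n : ℕ in atTop, ∀ v, a * Real.exp (n * G.logRho s) ≤
      ∑ p ∈ G.pathsFrom n v with (d - ε) * n ≤ G.pathCost p ∧ G.pathCost p ≤ (d + ε) * n,
        Real.exp (s * G.pathCost p) := by
  obtain ⟨a, _, ha, _, hab⟩ := hconn.exists_pathSum_bounds s
  -- Difference quotients of `Λ` at `s` tend to `d`, so small tilts `δ > 0` and `γ < 0` give both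
  -- tails a negative rate. Each tail then takes at most `a / 4` of the total `a`.
  have hslope := hasDerivAt_iff_tendsto_slope_zero.1 hd
  obtain ⟨δ, hδ1, hδ⟩ := (((hslope.mono_left (nhdsGT_le_nhdsNE 0)).eventually_lt_const (by linarith : d < d + ε)).and
      (self_mem_nhdsWithin (s := Ioi (0 : ℝ)))).exists
  obtain ⟨γ, hγ1, hγ⟩ := (((hslope.mono_left (nhdsLT_le_nhdsNE 0)).eventually_const_lt (by linarith : d - ε < d)).and
      (self_mem_nhdsWithin (s := Iio (0 : ℝ)))).exists
  have h1 : G.logRho (s + δ) - G.logRho s - δ * (d + ε) < 0 := by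
    have := mul_lt_mul_of_pos_left hδ1 hδ
    rw [smul_eq_mul, mul_inv_cancel_left₀ hδ.ne'] at this
    linarith
  have h2 : G.logRho (s + γ) - G.logRho s - γ * (d - ε) < 0 := by
    have := mul_lt_mul_of_neg_left hγ1 hγ
    rw [smul_eq_mul, mul_inv_cancel_left₀ hγ.ne] at this
    linarith
  refine ⟨a / 2, by positivity, ?_⟩
  filter_upwards [hconn.eventually_tail_le h1 (by positivity : 0 < a / 4),
    hconn.eventually_tail_le h2 (by positivity : 0 < a / 4)] with n hn1 hn2 v
  have key : G.pathSum s n v ≤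
      ∑ p ∈ G.pathsFrom n v with (d - ε) * n ≤ G.pathCost p ∧ G.pathCost p ≤ (d + ε) * n,
        Real.exp (s * G.pathCost p) +
      ∑ p ∈ G.pathsFrom n v with δ * ((d + ε) * n) ≤ δ * G.pathCost p,
        Real.exp (s * G.pathCost p) +
      ∑ p ∈ G.pathsFrom n v with γ * ((d - ε) * n) ≤ γ * G.pathCost p,
        Real.exp (s * G.pathCost p) := by
    rw [pathSum, Finset.sum_filter, Finset.sum_filter, Finset.sum_filter,
      ← Finset.sum_add_distrib, ← Finset.sum_add_distrib]
    refine Finset.sum_le_sum fun p _ => ?_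
    have hpos := Real.exp_pos (s * G.pathCost p)
    rcases lt_or_ge ((d + ε) * n) (G.pathCost p : ℝ) with h3 | h3
    · rw [if_pos (mul_le_mul_of_nonneg_left h3.le hδ.le)]
      split_ifs <;> linarith
    rcases lt_or_ge (G.pathCost p : ℝ) ((d - ε) * n) with h4 | h4
    · rw [if_pos (mul_le_mul_of_nonpos_left h4.le hγ.le)]
      split_ifs <;> linarith
    · rw [if_pos ⟨h4, h3⟩]
      split_ifs <;> linarith
  linarith [hn1 v, hn2 v, (hab n v).1]

/-- Since `s ≤ 0`, each path in the window weighs at most `exp (s (d - ε) n)`, so a large total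
weight forces many paths. -/
theorem StronglyConnected.eventually_le_card (hconn : G.StronglyConnected)
    (hd : HasDerivAt G.logRho d s) (hs : s ≤ 0) {ε : ℝ} (hε : 0 < ε) :
    ∃ a > 0, ∀ᶠ n : ℕ in atTop, ∀ v, a * Real.exp (n * (G.logRho s - s * (d - ε))) ≤
      ((G.pathsFrom n v).filter fun p => (G.pathCost p : ℝ) ≤ (d + ε) * n).card := by
  obtain ⟨a, ha, h⟩ := hconn.eventually_le_window hd hε
  refine ⟨a, ha, ?_⟩
  filter_upwards [h] with n hn v
  have h1 : ∑ p ∈ G.pathsFrom n v with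
        (d - ε) * n ≤ G.pathCost p ∧ G.pathCost p ≤ (d + ε) * n, Real.exp (s * G.pathCost p) ≤
      ((G.pathsFrom n v).filter fun p => (G.pathCost p : ℝ) ≤ (d + ε) * n).card *
        Real.exp (s * ((d - ε) * n)) := by
    refine (Finset.sum_le_card_nsmul _ _ (Real.exp (s * ((d - ε) * n))) fun p hp => ?_).trans ?_
    · exact Real.exp_le_exp.2 (mul_le_mul_of_nonpos_left (Finset.mem_filter.1 hp).2.1 hs)
    · rw [nsmul_eq_mul]
      refine mul_le_mul_of_nonneg_right ?_ (Real.exp_pos _).le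
      exact_mod_cast Finset.card_le_card
        (Finset.monotone_filter_right _ fun p _ (hp : _ ∧ _) => hp.2)
  rw [mul_sub, Real.exp_sub, ← mul_div_assoc, div_le_iff₀ (Real.exp_pos _)]
  refine (hn v).trans (h1.trans_eq ?_)
  congr 2
  ring

/-- The window at `s` contains a path of cost at most `(d + ε) n`; its weight at `σ` alone bounds
the path sum at `σ` from below. This makes Markov's bound nonnegative up to the rate `αup`. -/
theorem StronglyConnected.mul_deriv_le_logRho (hconn : G.StronglyConnected)
    (hd : HasDerivAt G.logRho d s) {σ : ℝ} (hσ : σ ≤ 0) : σ * d ≤ G.logRho σ := by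
  have hε : ∀ ε > 0, σ * (d + ε) ≤ G.logRho σ := fun ε hε => by
    obtain ⟨a, ha, h⟩ := hconn.eventually_le_window hd hε
    obtain ⟨_, b, _, hb, hab⟩ := hconn.exists_pathSum_bounds σ
    refine le_of_eventually_natCast_mul_le (c := Real.log b) ?_
    filter_upwards [h] with n hn
    let v := G.init (Classical.arbitrary E)
    obtain ⟨p, hp, -⟩ := Finset.exists_ne_zero_of_sum_ne_zero
      ((mul_pos ha (Real.exp_pos _)).trans_le (hn v)).ne'
    obtain ⟨hp1, -, hp2⟩ := Finset.mem_filter.1 hp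
    have h1 : Real.exp (n * (σ * (d + ε))) ≤ b * Real.exp (n * G.logRho σ) := by
      refine le_trans ?_ (hab n v).2
      refine le_trans ?_ (Finset.single_le_sum (fun q _ => (Real.exp_pos _).le) hp1)
      rw [Real.exp_le_exp]
      calc n * (σ * (d + ε)) = σ * ((d + ε) * n) := by ring
        _ ≤ _ := mul_le_mul_of_nonpos_left hp2 hσ
    rwa [← Real.exp_log hb, ← Real.exp_add, Real.exp_le_exp] at h1
  have hlim : Tendsto (fun ε : ℝ => σ * (d + ε)) (𝓝[>] 0) (𝓝 (σ * d)) := by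
    have : Continuous fun ε : ℝ => σ * (d + ε) := by fun_prop
    simpa using (this.tendsto 0).mono_left nhdsWithin_le_nhds
  exact le_of_tendsto hlim (eventually_nhdsWithin_of_forall hε)

end Chernoff

theorem isBoundedUnder_rate {V E S : Type*} [Fintype E] (G : CostGraph V E S)
    (v : V) {α : ℝ} (hα : 0 ≤ α) :
    IsBoundedUnder (· ≤ ·) atTop fun t : ℕ =>
      Real.logb 2 ((G.fixedFollowerSet v t ⌊α * t⌋₊).ncard : ℝ) / (t : ℝ) :=
  isBoundedUnder_of ⟨_, fun t => (G.fixedRate_mem_Icc v α hα t).2⟩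

theorem isCoboundedUnder_rate {V E S : Type*} [Fintype E] (G : CostGraph V E S)
    (v : V) {α : ℝ} (hα : 0 ≤ α) :
    IsCoboundedUnder (· ≤ ·) atTop fun t : ℕ =>
      Real.logb 2 ((G.fixedFollowerSet v t ⌊α * t⌋₊).ncard : ℝ) / (t : ℝ) :=
  (isBoundedUnder_of ⟨0, fun t => (G.fixedRate_mem_Icc v α hα t).1⟩ :
    IsBoundedUnder (· ≥ ·) atTop _).isCoboundedUnder_le

theorem le_fixedCapacity {V E S : Type*} [Fintype E] {G : CostGraph V E S} (v : V)
    {α : ℝ} (hα : 0 ≤ α) {c : ℝ} (h : ∀ᶠ t : ℕ in atTop, c ≤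
      Real.logb 2 ((G.fixedFollowerSet v t ⌊α * t⌋₊).ncard : ℝ) / (t : ℝ)) :
    c ≤ G.fixedCapacity v α :=
  le_limsup_of_frequently_le h.frequently (G.isBoundedUnder_rate v hα)

section Rate

variable [Nonempty E]

theorem StronglyConnected.eventually_le_rate_of_deriv (hconn : G.StronglyConnected)
    (hdet : G.Deterministic) {s d : ℝ} (hd : HasDerivAt G.logRho d s) (hd0 : 0 < d) (hs : s ≤ 0)
    {α : ℝ} (hα : 0 < α) (hαd : α * d < 1) {c : ℝ}
    (hc : c * Real.log 2 < α * (G.logRho s - s * d)) (v : V) :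
    ∀ᶠ t : ℕ in atTop, c ≤
      Real.logb 2 ((G.fixedFollowerSet v t ⌊α * t⌋₊).ncard : ℝ) / (t : ℝ) := by
  have hc1 : Continuous fun ε : ℝ => α * (d + ε) := by fun_prop
  have hc2 : Continuous fun ε : ℝ => α * (G.logRho s - s * (d - ε)) := by fun_prop
  obtain ⟨ε, ⟨hε1, hε2⟩, hε⟩ := (((((hc1.tendsto 0).eventually_lt_const (u := 1)
    (by simpa using hαd)).and ((hc2.tendsto 0).eventually_const_lt (u := c * Real.log 2)
    (by simpa using hc))).filter_mono nhdsWithin_le_nhds).and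
      (self_mem_nhdsWithin (s := Ioi (0 : ℝ)))).exists
  obtain ⟨a, ha, h⟩ := hconn.eventually_le_card hd hs hε
  have hfloor : Tendsto (fun t : ℕ => ⌊α * t⌋₊) atTop atTop :=
    tendsto_nat_floor_atTop.comp (tendsto_natCast_atTop_atTop.const_mul_atTop hα)
  have hlim := tendsto_add_floor_mul_add_mul_div hα.le (Real.log a)
    (G.logRho s - s * (d - ε)) 0
  rw [add_zero] at hlim
  filter_upwards [hfloor.eventually h, hlim.eventually_const_lt hε2, eventually_gt_atTop 0]
    with t ht1 ht2 ht
  have ht' : (0 : ℝ) < t := by exact_mod_cast ht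
  set n := ⌊α * t⌋₊
  have hn : (n : ℝ) ≤ α * t := Nat.floor_le (by positivity)
  rw [hdet.ncard_fixedFollowerSet]
  have hle : a * Real.exp (n * (G.logRho s - s * (d - ε))) ≤ G.pathCount v t n := by
    refine (ht1 v).trans ?_
    rw [pathCount]
    refine Nat.cast_le.2 (Finset.card_le_card (Finset.monotone_filter_right _ fun p _ hp => ?_))
    have : (G.pathCost p : ℝ) ≤ t := by
      refine le_trans hp ?_
      calc (d + ε) * n ≤ (d + ε) * (α * t) := by gcongr
        _ = α * (d + ε) * t := by ring
        _ ≤ 1 * t := by gcongr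
        _ = t := one_mul _
    exact_mod_cast this
  have hlog := Real.log_le_log (by positivity) hle
  rw [Real.log_mul ha.ne' (Real.exp_pos _).ne', Real.log_exp] at hlog
  rw [Real.logb, div_div, mul_comm, ← div_div, le_div_iff₀ (Real.log_pos one_lt_two)]
  refine ht2.le.trans ?_
  rw [zero_mul, add_zero]
  gcongr

/-- Markov's inequality on the logarithmic scale. Hypothesis `h0` covers those `t` with no path at
all, where the rate is `0` by convention. -/
theorem StronglyConnected.eventually_rate_le (hconn : G.StronglyConnected)
    (hdet : G.Deterministic) {s : ℝ} (hs : s ≤ 0) {α : ℝ} (hα : 0 ≤ α)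
    (h0 : 0 ≤ α * G.logRho s - s) {c : ℝ} (hc : α * G.logRho s - s < c * Real.log 2) (v : V) :
    ∀ᶠ t : ℕ in atTop,
      Real.logb 2 ((G.fixedFollowerSet v t ⌊α * t⌋₊).ncard : ℝ) / (t : ℝ) ≤ c := by
  obtain ⟨_, b, _, hb, hab⟩ := hconn.exists_pathSum_bounds s
  have hlim := tendsto_add_floor_mul_add_mul_div hα (Real.log b) (G.logRho s) (-s)
  have hc0 : 0 ≤ c :=
    (pos_of_mul_pos_left (h0.trans_lt hc) (Real.log_pos one_lt_two).le).le
  filter_upwards [hlim.eventually_lt_const (by simpa [sub_eq_add_neg] using hc),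
    eventually_gt_atTop 0] with t ht1 ht
  have ht' : (0 : ℝ) < t := by exact_mod_cast ht
  set n := ⌊α * t⌋₊
  rw [hdet.ncard_fixedFollowerSet]
  rcases Nat.eq_zero_or_pos (G.pathCount v t n) with hz | hz
  · simpa [hz] using hc0
  have hle : (G.pathCount v t n : ℝ) ≤ Real.exp (-(s * t)) * (b * Real.exp (n * G.logRho s)) :=
    (pathCount_le_exp_mul_pathSum hs v t n).trans
      (mul_le_mul_of_nonneg_left (hab n v).2 (Real.exp_pos _).le)
  have hlog := Real.log_le_log (by exact_mod_cast hz) hle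
  rw [Real.log_mul (Real.exp_pos _).ne' (mul_pos hb (Real.exp_pos _)).ne',
    Real.log_mul hb.ne' (Real.exp_pos _).ne', Real.log_exp, Real.log_exp] at hlog
  rw [Real.logb, div_div, mul_comm, ← div_div, div_le_iff₀ (Real.log_pos one_lt_two)]
  refine le_trans ?_ ht1.le
  gcongr
  linarith

theorem StronglyConnected.fixedCapacity_mul_log_le (hconn : G.StronglyConnected)
    (hdet : G.Deterministic) {s : ℝ} (hs : s ≤ 0) {α : ℝ} (hα : 0 ≤ α)
    (h0 : 0 ≤ α * G.logRho s - s) (v : V) :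
    G.fixedCapacity v α * Real.log 2 ≤ α * G.logRho s - s := by
  have hlog := Real.log_pos one_lt_two
  rw [← le_div_iff₀ hlog]
  refine le_of_forall_gt_imp_ge_of_dense fun c hc => ?_
  rw [div_lt_iff₀ hlog] at hc
  exact limsup_le_of_le (G.isCoboundedUnder_rate v hα) (hconn.eventually_rate_le hdet hs hα h0 hc v)

end Rate

/-! ### The variational formula and concavity -/

section Concavity

/-- The lower bound in the formula `C(α) log 2 = inf_{s ≤ 0} (α log ρ(exp s) - s)`. -/
theorem StronglyConnected.eventually_le_rate (hconn : G.StronglyConnected)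
    (hdet : G.Deterministic) (hdiv : G.CostDiverse) {α : ℝ} (hα : 0 ≤ α)
    (hα1 : ∃ s, α * deriv G.logRho s < 1) {c η : ℝ} (hη : 0 < η)
    (hc : ∀ s ≤ 0, c * Real.log 2 + η ≤ α * G.logRho s - s) (v : V) :
    ∀ᶠ t : ℕ in atTop, c ≤
      Real.logb 2 ((G.fixedFollowerSet v t ⌊α * t⌋₊).ncard : ℝ) / (t : ℝ) := by
  have hlog := Real.log_pos one_lt_two
  have hcost := hdiv.exists_cost_pos
  have : Nonempty E := ⟨hcost.choose⟩
  have hder : ∀ s, 0 < deriv G.logRho s ∧ HasDerivAt G.logRho (deriv G.logRho s) s := fun s => by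
    obtain ⟨d, hd, h⟩ := hconn.exists_hasDerivAt_logRho hcost s
    rw [h.deriv]
    exact ⟨hd, h⟩
  rcases hα.eq_or_lt with rfl | hα0
  · have h0 := hc 0 le_rfl
    have : c ≤ 0 := by
      by_contra! hc0
      have := mul_pos hc0 hlog
      linarith
    exact Eventually.of_forall fun t => this.trans (G.fixedRate_mem_Icc v 0 le_rfl t).1
  -- Here typical unweighted paths already fit the budget, so `s = 0` serves.
  rcases lt_or_ge (α * deriv G.logRho 0) 1 with h1 | h1
  · refine hconn.eventually_le_rate_of_deriv hdet (hder 0).2 (hder 0).1 le_rfl hα0 h1 ?_ v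
    have := hc 0 le_rfl
    linarith
  obtain ⟨s₁, hs₁⟩ := hα1
  have hs₁0 : s₁ < 0 := by
    by_contra! hcon
    have hmono := (hconn.strictConvexOn_logRho hdiv).strictMonoOn_deriv
      (fun x _ => (hder x).2.differentiableAt)
    have := hmono.monotoneOn (mem_univ 0) (mem_univ s₁) hcon
    have := mul_le_mul_of_nonneg_left this hα
    linarith
  -- The first bound on `δ` places `(1 - δ) / α` strictly above `Λ'(s₁)`, so that Darboux's theorem
  -- yields `s` between `s₁` and `0` with `α Λ'(s) = 1 - δ`. The second keeps the resulting loss `-s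
  -- δ` below the margin `η`.
  obtain ⟨δ, hδ0, hδ1, hδ2⟩ : ∃ δ > 0, δ < 1 - α * deriv G.logRho s₁ ∧ δ * -s₁ < η := by
    have hp : 0 < 1 - α * deriv G.logRho s₁ := by linarith
    have hq : 0 < η / -s₁ := div_pos hη (by linarith)
    obtain ⟨δ, h1, h2⟩ := exists_between (lt_min hp hq)
    exact ⟨δ, h1, (lt_min_iff.1 h2).1, (lt_div_iff₀ (by linarith)).1 (lt_min_iff.1 h2).2⟩
  obtain ⟨s, hs, hsd⟩ := exists_hasDerivWithinAt_eq_of_gt_of_lt hs₁0.le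
    (fun x _ => (hder x).2.hasDerivWithinAt) (m := (1 - δ) / α)
    (by rw [lt_div_iff₀ hα0]; linarith) (by rw [div_lt_iff₀ hα0]; linarith)
  have hαs : α * deriv G.logRho s = 1 - δ := by rw [hsd, mul_div_cancel₀ _ hα0.ne']
  refine hconn.eventually_le_rate_of_deriv hdet (hder s).2 (hder s).1 hs.2.le hα0
    (by linarith) ?_ v
  have h2 := hc s hs.2.le
  have h3 : α * (G.logRho s - s * deriv G.logRho s) = α * G.logRho s - s + s * δ := by
    linear_combination -s * hαs
  have h4 : s₁ * δ ≤ s * δ := mul_le_mul_of_nonneg_right hs.1.le hδ0.le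
  linarith

variable (G) in
/-- The largest mean length per unit of cost. -/
noncomputable def maxLengthRate : EReal := ⨆ s : ℝ, ((1 / deriv G.logRho s : ℝ) : EReal)

theorem StronglyConnected.deriv_logRho_pos (hconn : G.StronglyConnected)
    (hdiv : G.CostDiverse) (s : ℝ) : 0 < deriv G.logRho s := by
  obtain ⟨d, hd, h⟩ := hconn.exists_hasDerivAt_logRho hdiv.exists_cost_pos s
  rwa [h.deriv]

theorem StronglyConnected.differentiable_logRho (hconn : G.StronglyConnected)
    (hdiv : G.CostDiverse) : Differentiable ℝ G.logRho := fun s =>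
  (hconn.exists_hasDerivAt_logRho hdiv.exists_cost_pos s).choose_spec.2.differentiableAt

theorem StronglyConnected.strictMono_deriv_logRho (hconn : G.StronglyConnected)
    (hdiv : G.CostDiverse) : StrictMono (deriv G.logRho) :=
  strictMonoOn_univ.1 ((hconn.strictConvexOn_logRho hdiv).strictMonoOn_deriv
    fun x _ => hconn.differentiable_logRho hdiv x)

/-- If `Λ(σ) < 0`, then `σ Λ'(s) ≤ Λ(σ)` bounds every `1/Λ'(s)`, hence `α`, by `σ / Λ(σ)`. -/
theorem StronglyConnected.nonneg_of_le_maxLengthRate (hconn : G.StronglyConnected)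
    (hdiv : G.CostDiverse) {α : ℝ} (hα : 0 ≤ α) (hα' : (α : EReal) ≤ G.maxLengthRate) {σ : ℝ}
    (hσ : σ ≤ 0) : 0 ≤ α * G.logRho σ - σ := by
  have : Nonempty E := ⟨hdiv.exists_cost_pos.choose⟩
  rcases le_or_gt 0 (G.logRho σ) with h | h
  · linarith [mul_nonneg hα h]
  have h1 : G.maxLengthRate ≤ ((σ / G.logRho σ : ℝ) : EReal) := by
    refine iSup_le fun s => EReal.coe_le_coe_iff.2 ?_
    have h2 := hconn.mul_deriv_le_logRho (hconn.differentiable_logRho hdiv s).hasDerivAt hσ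
    rw [div_le_iff₀ (hconn.deriv_logRho_pos hdiv s), div_mul_eq_mul_div,
      le_div_iff_of_neg h, one_mul]
    exact h2
  have h3 := (le_div_iff_of_neg h).1 (EReal.coe_le_coe_iff.1 (hα'.trans h1))
  linarith

/-- The upper bound is affine in the rate and holds at both end points, `αup` included. The lower
bound is needed only at a proper convex combination `z`, which is strictly below `αup`. -/
theorem StronglyConnected.concaveOn_fixedCapacity (hconn : G.StronglyConnected)
    (hdet : G.Deterministic) (hdiv : G.CostDiverse) (v : V) :
    ConcaveOn ℝ {α : ℝ | 0 ≤ α ∧ (α : EReal) ≤ G.maxLengthRate} (G.fixedCapacity v) := by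
  have : Nonempty E := ⟨hdiv.exists_cost_pos.choose⟩
  have hconv : Convex ℝ {α : ℝ | 0 ≤ α ∧ (α : EReal) ≤ G.maxLengthRate} := by
    refine Set.OrdConnected.convex ⟨fun x hx y hy z hz => ⟨hx.1.trans hz.1, ?_⟩⟩
    exact (EReal.coe_le_coe_iff.2 hz.2).trans hy.2
  refine LinearOrder.concaveOn_of_lt hconv fun x hx y hy hxy a b ha hb hab => ?_
  have hz := hconv hx hy ha.le hb.le hab
  simp only [smul_eq_mul] at hz ⊢
  set z := a * x + b * y
  have hzy : z < y := by
    have : a * x < a * y := mul_lt_mul_of_pos_left hxy ha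
    have : a * y + b * y = y := by rw [← add_mul, hab, one_mul]
    linarith
  obtain ⟨s₁, hs₁⟩ := lt_iSup_iff.1 ((EReal.coe_lt_coe_iff.2 hzy).trans_le hy.2)
  have hzs : z * deriv G.logRho s₁ < 1 :=
    (lt_div_iff₀ (hconn.deriv_logRho_pos hdiv s₁)).1 (EReal.coe_lt_coe_iff.1 hs₁)
  refine le_of_forall_lt_imp_le_of_dense fun c hc => le_fixedCapacity v hz.1 ?_
  refine hconn.eventually_le_rate hdet hdiv hz.1 ⟨s₁, hzs⟩
    (mul_pos (sub_pos.2 hc) (Real.log_pos one_lt_two)) (fun s hs => ?_) v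
  have h1 := hconn.fixedCapacity_mul_log_le hdet hs hx.1
    (hconn.nonneg_of_le_maxLengthRate hdiv hx.1 hx.2 hs) v
  have h2 := hconn.fixedCapacity_mul_log_le hdet hs hy.1
    (hconn.nonneg_of_le_maxLengthRate hdiv hy.1 hy.2 hs) v
  have h3 := add_le_add (mul_le_mul_of_nonneg_left h1 ha.le) (mul_le_mul_of_nonneg_left h2 hb.le)
  have h4 : a * (x * G.logRho s - s) + b * (y * G.logRho s - s) = z * G.logRho s - s := by
    linear_combination -s * hab
  linarith

theorem StronglyConnected.tendsto_maxLengthRate (hconn : G.StronglyConnected)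
    (hdiv : G.CostDiverse) :
    Tendsto (fun x : ℝ => ((G.rho x / (x * deriv G.rho x) : ℝ) : EReal))
        (𝓝[>] 0) (𝓝 G.maxLengthRate) := by
  have : Nonempty E := ⟨hdiv.exists_cost_pos.choose⟩
  have hanti : Antitone fun s : ℝ => ((1 / deriv G.logRho s : ℝ) : EReal) := fun s t hst =>
    EReal.coe_le_coe_iff.2 (one_div_le_one_div_of_le (hconn.deriv_logRho_pos hdiv s)
      ((hconn.strictMono_deriv_logRho hdiv).monotone hst))
  refine ((tendsto_atBot_iSup hanti).comp Real.tendsto_log_nhdsGT_zero).congr' ?_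
  filter_upwards [self_mem_nhdsWithin] with x hx
  rw [mem_Ioi] at hx
  have hρ : 0 < G.rho x := by simpa [Real.exp_log hx] using hconn.rho_exp_pos (Real.log x)
  have hd := hconn.deriv_logRho_pos hdiv (Real.log x)
  rw [Function.comp_apply, (hconn.hasDerivAt_rho hdiv.exists_cost_pos hx).deriv]
  congr 1
  field_simp

end Concavity

end CostGraph

/-! ### Graphs without cycles of cost zero: the variable-length capacity -/

namespace CostGraph

section FollowerSet

theorem NoZeroCostCycle.followerSet_subset {V E S : Type*} [Fintype V] {G : CostGraph V E S}
    (hz : G.NoZeroCostCycle) (v : V) (t : ℕ) :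
    G.followerSet v t ⊆
      ⋃ n ∈ Finset.range ((t + 1) * (Fintype.card V + 1)), G.fixedFollowerSet v t n := by
  rintro w ⟨p, u, hp, hc, rfl⟩
  simp only [mem_iUnion, Finset.mem_range, exists_prop]
  refine ⟨p.length, ?_, ⟨p, u, hp, hc, rfl⟩, List.length_map _⟩
  by_contra! h
  have := hp.le_pathCost hz _ h
  omega

variable {V E S : Type*} [Fintype V] [Fintype E] {G : CostGraph V E S}

theorem NoZeroCostCycle.finite_followerSet (hz : G.NoZeroCostCycle) (v : V) (t : ℕ) :
    (G.followerSet v t).Finite :=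
  (Set.Finite.biUnion (Finset.finite_toSet _) fun n _ => finite_fixedFollowerSet v t n).subset
    (hz.followerSet_subset v t)

theorem NoZeroCostCycle.ncard_followerSet_le (hz : G.NoZeroCostCycle) (hdet : G.Deterministic)
    (v : V) (t : ℕ) : (G.followerSet v t).ncard ≤
      ∑ n ∈ Finset.range ((t + 1) * (Fintype.card V + 1)), G.pathCount v t n := by
  refine (ncard_le_ncard (hz.followerSet_subset v t) (Set.Finite.biUnion (Finset.finite_toSet _)
    fun n _ => finite_fixedFollowerSet v t n)).trans ?_
  refine (Finset.set_ncard_biUnion_le _ _).trans_eq ?_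
  exact Finset.sum_congr rfl fun n _ => hdet.ncard_fixedFollowerSet v t n

theorem NoZeroCostCycle.ncard_followerSet_pos (hz : G.NoZeroCostCycle) (v : V) (t : ℕ) :
    0 < (G.followerSet v t).ncard :=
  (ncard_pos (hz.finite_followerSet v t)).2 ⟨[], [], v, rfl, Nat.zero_le _, rfl⟩

theorem NoZeroCostCycle.variableCapacity_eq_limsup (hz : G.NoZeroCostCycle) (v : V) :
    G.variableCapacity v = limsup (fun t : ℕ =>
      ((Real.log (G.followerSet v t).ncard / (Real.log 2 * t) : ℝ) : EReal)) atTop := by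
  refine limsup_congr (Eventually.of_forall fun t => ?_)
  have hpos := hz.ncard_followerSet_pos v t
  have h1 : (((G.followerSet v t).encard : ENNReal)) =
      ENNReal.ofReal ((G.followerSet v t).ncard : ℝ) := by
    rw [← (hz.finite_followerSet v t).cast_ncard_eq, ENNReal.ofReal_natCast]
    rfl
  rw [h1, ENNReal.log_ofReal_of_pos (by exact_mod_cast hpos), EReal.coe_div]

end FollowerSet

variable {V E S : Type*} [Fintype V] [DecidableEq V] [Fintype E] {G : CostGraph V E S}

/-- Paths of length `k (|V| + 1)` cost at least `k`, so their weight at `s` is at most `exp (s k)`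
times their number; compare growth rates in `k`. -/
theorem StronglyConnected.logRho_le_of_noZeroCostCycle (hconn : G.StronglyConnected)
    [Nonempty E] (hz : G.NoZeroCostCycle) {s : ℝ} (hs : s ≤ 0) :
    (Fintype.card V + 1) * G.logRho s ≤ s + (Fintype.card V + 1) * G.logRho 0 := by
  obtain ⟨a, _, ha, _, hab⟩ := hconn.exists_pathSum_bounds s
  obtain ⟨_, b, _, hb, hab'⟩ := hconn.exists_pathSum_bounds 0
  have hb' : 0 < b / a := div_pos hb ha
  refine le_of_eventually_natCast_mul_le (c := Real.log (b / a)) (Eventually.of_forall fun k => ?_)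
  let v := G.init (Classical.arbitrary E)
  set n := k * (Fintype.card V + 1) with hn
  have h1 : G.pathSum s n v ≤ Real.exp (s * k) * G.pathSum 0 n v := by
    rw [pathSum, pathSum, Finset.mul_sum]
    refine Finset.sum_le_sum fun p hp => ?_
    rw [zero_mul, Real.exp_zero, mul_one, Real.exp_le_exp]
    obtain ⟨hl, w, hw⟩ := mem_pathsFrom.1 hp
    exact mul_le_mul_of_nonpos_left (by exact_mod_cast hw.le_pathCost hz k hl.ge) hs
  have h2 := (hab n v).1.trans (h1.trans
    (mul_le_mul_of_nonneg_left (hab' n v).2 (Real.exp_pos _).le))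
  have h3 : Real.exp (n * G.logRho s) ≤
      Real.exp (Real.log (b / a) + (s * k + n * G.logRho 0)) := by
    rw [Real.exp_add, Real.exp_log hb', Real.exp_add, div_mul_eq_mul_div, le_div_iff₀ ha]
    linarith
  have h4 := Real.exp_le_exp.1 h3
  rw [hn] at h4
  push_cast at h4
  linarith

theorem StronglyConnected.exists_logRho_eq_zero (hconn : G.StronglyConnected)
    (hdiv : G.CostDiverse) (hz : G.NoZeroCostCycle) : ∃ s ≤ 0, G.logRho s = 0 := by
  have : Nonempty E := ⟨hdiv.exists_cost_pos.choose⟩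
  have h0 : 0 ≤ G.logRho 0 := by
    -- The case `σ = 0`.
    simpa using hconn.mul_deriv_le_logRho (hconn.differentiable_logRho hdiv 0).hasDerivAt le_rfl
  set N : ℝ := Fintype.card V + 1 with hN
  have hN0 : 0 < N := by positivity
  have hs : -(N * G.logRho 0) ≤ 0 := by have := mul_nonneg hN0.le h0; linarith
  have h1 : G.logRho (-(N * G.logRho 0)) ≤ 0 := by
    have h2 := hconn.logRho_le_of_noZeroCostCycle hz hs
    rw [← hN] at h2
    by_contra! h3
    have := mul_pos hN0 h3
    linarith
  obtain ⟨s, hs', hs0⟩ := intermediate_value_Icc hs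
    (hconn.differentiable_logRho hdiv).continuous.continuousOn ⟨h1, h0⟩
  exact ⟨s, hs'.2, hs0⟩

theorem StronglyConnected.deriv_mul_sub_le_logRho (hconn : G.StronglyConnected)
    (hdiv : G.CostDiverse) {s₀ : ℝ} (h0 : G.logRho s₀ = 0) (s : ℝ) :
    deriv G.logRho s₀ * (s - s₀) ≤ G.logRho s := by
  have hc := hconn.strictConvexOn_logRho hdiv
  have hd := (hconn.differentiable_logRho hdiv s₀).hasDerivAt
  rcases lt_trichotomy s s₀ with h | rfl | h
  · have := hc.convexOn.slope_le_of_hasDerivAt (mem_univ _) (mem_univ _) h hd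
    rw [slope_def_field, div_le_iff₀ (sub_pos.2 h), h0] at this
    linarith
  · simp [h0]
  · have := hc.convexOn.le_slope_of_hasDerivAt (mem_univ _) (mem_univ _) h hd
    rw [slope_def_field, le_div_iff₀ (sub_pos.2 h), h0] at this
    linarith

/-- Words of one length already give the lower bound. For the upper bound, at most `(t + 1)(|V| +
1)` lengths occur, and as `Λ(s₀) = 0` each contributes at most `b exp (-s₀ t)`. -/
theorem StronglyConnected.tendsto_log_ncard_followerSet (hconn : G.StronglyConnected)
    (hdet : G.Deterministic) (hdiv : G.CostDiverse) (hz : G.NoZeroCostCycle) {s₀ : ℝ}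
    (hs₀ : s₀ ≤ 0) (h0 : G.logRho s₀ = 0) (v : V) {α : ℝ}
    (hlow : ∀ c < -s₀ / Real.log 2, ∀ᶠ t : ℕ in atTop, c ≤
      Real.logb 2 ((G.fixedFollowerSet v t ⌊α * t⌋₊).ncard : ℝ) / (t : ℝ)) :
    Tendsto (fun t : ℕ => Real.log (G.followerSet v t).ncard / (Real.log 2 * t)) atTop
      (𝓝 (-s₀ / Real.log 2)) := by
  have : Nonempty E := ⟨hdiv.exists_cost_pos.choose⟩
  have hlog := Real.log_pos one_lt_two
  refine tendsto_order.2 ⟨fun c hc => ?_, fun c hc => ?_⟩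
  · obtain ⟨c', hc1, hc2⟩ := exists_between hc
    filter_upwards [hlow c' hc2, eventually_gt_atTop 0] with t ht ht0
    have hpos := hz.ncard_followerSet_pos v t
    refine hc1.trans_le (ht.trans ?_)
    rw [Real.logb, div_div]
    have hle : (G.fixedFollowerSet v t ⌊α * t⌋₊).ncard ≤ (G.followerSet v t).ncard :=
      ncard_le_ncard inter_subset_left (hz.finite_followerSet v t)
    refine div_le_div_of_nonneg_right ?_ (mul_nonneg hlog.le t.cast_nonneg)
    rcases Nat.eq_zero_or_pos (G.fixedFollowerSet v t ⌊α * t⌋₊).ncard with hzero | hp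
    · rw [hzero, Nat.cast_zero, Real.log_zero]
      exact Real.log_natCast_nonneg _
    · exact Real.log_le_log (by exact_mod_cast hp) (by exact_mod_cast hle)
  · obtain ⟨_, b, _, hb, hab⟩ := hconn.exists_pathSum_bounds s₀
    set K : ℝ := (Fintype.card V + 1) * b with hK
    have hK0 : 0 < K := by positivity
    have hbound : ∀ t : ℕ, Real.log (G.followerSet v t).ncard ≤
        Real.log K + Real.log (t + 1 : ℕ) + -s₀ * t := fun t => by
      have h1 : ((G.followerSet v t).ncard : ℝ) ≤ K * (t + 1 : ℕ) * Real.exp (-s₀ * t) := by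
        calc ((G.followerSet v t).ncard : ℝ)
            ≤ ∑ n ∈ Finset.range ((t + 1) * (Fintype.card V + 1)), (G.pathCount v t n : ℝ) := by
              exact_mod_cast hz.ncard_followerSet_le hdet v t
          _ ≤ ∑ n ∈ Finset.range ((t + 1) * (Fintype.card V + 1)),
                Real.exp (-(s₀ * t)) * b := by
              refine Finset.sum_le_sum fun n _ => (pathCount_le_exp_mul_pathSum hs₀ v t n).trans ?_
              have := (hab n v).2
              rw [h0, mul_zero, Real.exp_zero, mul_one] at this
              gcongr
          _ = _ := by
              rw [Finset.sum_const, Finset.card_range, nsmul_eq_mul, hK]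
              push_cast
              ring_nf
      have h2 := Real.log_le_log (by exact_mod_cast hz.ncard_followerSet_pos v t) h1
      rwa [Real.log_mul (by positivity) (Real.exp_pos _).ne', Real.log_mul hK0.ne' (by positivity),
        Real.log_exp] at h2
    have hlim : Tendsto (fun t : ℕ => (Real.log K + Real.log (t + 1 : ℕ) + -s₀ * t) / t) atTop
        (𝓝 (-s₀)) := by
      have h1 : Tendsto (fun t : ℕ => Real.log (t + 1 : ℕ) / t) atTop (𝓝 0) := by
        have h2 : Tendsto (fun x : ℝ => Real.log x / (1 * x + -1)) atTop (𝓝 0) := by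
          simpa using Real.tendsto_pow_log_div_mul_add_atTop 1 (-1) 1 one_ne_zero
        refine ((h2.comp tendsto_natCast_atTop_atTop).comp (tendsto_add_atTop_nat 1)).congr
          fun t => ?_
        simp
      have h3 := ((tendsto_const_div_atTop_nhds_zero_nat (Real.log K)).add h1).add_const (-s₀)
      rw [add_zero, zero_add] at h3
      refine h3.congr' ?_
      filter_upwards [eventually_gt_atTop 0] with t ht
      have : (t : ℝ) ≠ 0 := by positivity
      field_simp
    rw [gt_iff_lt, div_lt_iff₀ hlog] at hc
    filter_upwards [hlim.eventually_lt_const hc, eventually_gt_atTop 0] with t ht ht0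
    have ht' : (0 : ℝ) < t := by exact_mod_cast ht0
    rw [mul_comm (Real.log 2), ← div_div, div_lt_iff₀ hlog]
    refine lt_of_le_of_lt ?_ ht
    gcongr
    exact hbound t

theorem StronglyConnected.exists_capacity (hconn : G.StronglyConnected)
    (hdet : G.Deterministic) (hdiv : G.CostDiverse) (hz : G.NoZeroCostCycle) :
    ∃ C αstar : ℝ, (∀ v : V, G.variableCapacity v = (C : EReal)) ∧
      αstar = (2 : ℝ) ^ C / deriv G.rho ((2 : ℝ) ^ (-C)) ∧
      0 < αstar ∧ (αstar : EReal) ≤ G.maxLengthRate ∧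
      ∀ v : V, G.fixedCapacity v αstar = C ∧
        IsMaxOn (G.fixedCapacity v) (Set.Ici 0) αstar := by
  have : Nonempty E := ⟨hdiv.exists_cost_pos.choose⟩
  have hlog := Real.log_pos one_lt_two
  obtain ⟨s₀, hs₀, h0⟩ := hconn.exists_logRho_eq_zero hdiv hz
  have hd := hconn.deriv_logRho_pos hdiv s₀
  set d := deriv G.logRho s₀ with hd_def
  have hα : 0 < 1 / d := one_div_pos.2 hd
  have hup : ∀ v : V, ∀ α : ℝ, 0 ≤ α → G.fixedCapacity v α ≤ -s₀ / Real.log 2 :=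
    fun v α hα => by
    have := hconn.fixedCapacity_mul_log_le hdet hs₀ hα (by rw [h0]; linarith) v
    rw [h0] at this
    rw [le_div_iff₀ hlog]
    linarith
  have hlow : ∀ v : V, ∀ c < -s₀ / Real.log 2, ∀ᶠ t : ℕ in atTop, c ≤
      Real.logb 2 ((G.fixedFollowerSet v t ⌊1 / d * t⌋₊).ncard : ℝ) / (t : ℝ) := fun v c hc => by
    rw [lt_div_iff₀ hlog] at hc
    -- Strict monotonicity gives `Λ'(s₀ - 1) < Λ'(s₀)`, so `s₀ - 1` witnesses that `1 / d` is below
    -- the critical rate.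
    refine hconn.eventually_le_rate hdet hdiv hα.le ⟨s₀ - 1, ?_⟩ (sub_pos.2 hc)
      (fun s _ => ?_) v
    · rw [one_div_mul_eq_div, div_lt_one hd]
      exact hconn.strictMono_deriv_logRho hdiv (sub_one_lt s₀)
    -- The tangent at `s₀` gives `Λ(s) / d - s ≥ -s₀`: for this rate the infimum is attained at
    -- `s₀`.
    · have h1 := mul_le_mul_of_nonneg_left (hconn.deriv_mul_sub_le_logRho hdiv h0 s) hα.le
      rw [← hd_def, ← mul_assoc, one_div_mul_cancel hd.ne'] at h1
      linarith
  have heq : ∀ v : V, G.fixedCapacity v (1 / d) = -s₀ / Real.log 2 := fun v =>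
    le_antisymm (hup v _ hα.le)
      (le_of_forall_lt_imp_le_of_dense fun c hc => le_fixedCapacity v hα.le (hlow v c hc))
  refine ⟨-s₀ / Real.log 2, 1 / d, fun v => ?_, ?_, hα,
    le_iSup (fun s : ℝ => ((1 / deriv G.logRho s : ℝ) : EReal)) s₀, fun v => ⟨heq v, ?_⟩⟩
  · rw [hz.variableCapacity_eq_limsup]
    exact ((continuous_coe_real_ereal.tendsto _).comp
      (hconn.tendsto_log_ncard_followerSet hdet hdiv hz hs₀ h0 v (hlow v))).limsup_eq
  · have h1 : (2 : ℝ) ^ (-s₀ / Real.log 2) = Real.exp (-s₀) := by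
      rw [Real.rpow_def_of_pos two_pos, mul_div_cancel₀ _ hlog.ne']
    have h2 : (2 : ℝ) ^ (-(-s₀ / Real.log 2)) = Real.exp s₀ := by
      rw [Real.rpow_neg zero_le_two, h1, Real.exp_neg, inv_inv]
    rw [h2, h1, (hconn.hasDerivAt_rho hdiv.exists_cost_pos (Real.exp_pos s₀)).deriv,
      ← hconn.exp_logRho, h0, Real.exp_zero, one_mul, Real.log_exp, ← hd_def, Real.exp_neg]
    have := (Real.exp_pos s₀).ne'
    field_simp
  · intro α hα0
    rw [mem_ofPred_eq, heq]
    exact hup v α hα0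

end CostGraph

theorem mainTheorem8 {V E S : Type*} [Fintype V] [DecidableEq V] [Fintype E]
    (G : CostGraph V E S) (hconn : G.StronglyConnected) (hdet : G.Deterministic)
    (hdiv : G.CostDiverse) :
    DifferentiableOn ℝ G.rho (Set.Ioi 0) ∧ (∀ x : ℝ, 0 < x → 0 < deriv G.rho x) ∧
    ∃ αup : EReal,
      Tendsto (fun x : ℝ => ((G.rho x / (x * deriv G.rho x) : ℝ) : EReal))
        (𝓝[>] 0) (𝓝 αup) ∧
      (∀ v : V, ConcaveOn ℝ {α : ℝ | 0 ≤ α ∧ (α : EReal) ≤ αup} (G.fixedCapacity v)) ∧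
      (G.NoZeroCostCycle →
        ∃ C αstar : ℝ, (∀ v : V, G.variableCapacity v = (C : EReal)) ∧
          αstar = (2 : ℝ) ^ C / deriv G.rho ((2 : ℝ) ^ (-C)) ∧
          0 < αstar ∧ (αstar : EReal) ≤ αup ∧
          ∀ v : V, G.fixedCapacity v αstar = C ∧
            IsMaxOn (G.fixedCapacity v) (Set.Ici 0) αstar) := by
  have hcost := hdiv.exists_cost_pos
  have : Nonempty E := ⟨hcost.choose⟩
  refine ⟨fun x hx => (hconn.hasDerivAt_rho hcost hx).differentiableAt.differentiableWithinAt,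
    fun x hx => ?_, G.maxLengthRate, hconn.tendsto_maxLengthRate hdiv,
    hconn.concaveOn_fixedCapacity hdet hdiv, hconn.exists_capacity hdet hdiv⟩
  rw [(hconn.hasDerivAt_rho hcost hx).deriv]
  have hρ : 0 < G.rho x := by simpa [Real.exp_log hx] using hconn.rho_exp_pos (Real.log x)
  exact div_pos (mul_pos hρ (hconn.deriv_logRho_pos hdiv _)) hx
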